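/- Let $F$ be a nontrivial free group, of finite or infinite rank, and let $x\in F$. An element of $F$ is called primitive if it belongs to some free basis of $F$, and $|y|_p$ denotes the least number of primitive elements whose product is $y$. An Aut-norm on $F$ is the word norm of a generating set of the form $\{\psi(s): s\in S\cup S^{-1},\ \psi\in\mathrm{Aut}(F)\}$ with $S\subset F$ finite; any two such norms are bi-Lipschitz equivalent, and $|\cdot|_p$ is one of them. Call $x$ separable if it is conjugate to an element of a proper free factor of $F$, that is, if $F=F_1*F_2$ with $F_2\neq 1$ and $x$ is conjugate into $F_1$. Call $x$ undistorted in a norm $|\cdot|$ if there is $C>0$ such that $|x^n|>Cn$ for all $n\ge 1$. For a free basis $B$ of $F$ and $w,y\in F$ let $C_w(y)$ be the number of (possibly overlapping) occurrences of the reduced word of $w$ in $B$ as a subword of the reduced word of $y$ in $B$, and let $Br_w(y)=C_w(y)-C_w(y^{-1})$. Then exactly one of the following holds. a) $x$ is separable. In this case $|x^n|_p\le 2$ for all $n\in\mathbb Z$, and the cyclic subgroup $\langle x\rangle$ is bounded in every Aut-norm. b) $x$ is not separable. In this case $x$ is undistorted in the primitive norm and in every Aut-norm. Moreover there is a homogeneous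 quasimorphism $q\colon F\to\mathbb R$ that is bounded on the set of all primitive elements and satisfies $q(x)\neq 0$; namely, there is a free basis $B$ of $F$ in which $x$ is cyclically reduced such that the homogenization $q(y)=\lim_{n\to\infty}Br_{x^2}(y^n)/n$ of the Brooks counting function $Br_{x^2}$ with respect to $B$ exists and has these properties. -/

import Mathlib

namespace AutNorm

universe u

/-- The word norm of `x` with respect to `S`: the least `n` such that `x` is a product of `n`
elements of `S`. -/
noncomputable def wordNorm {G : Type u} [Group G] (S : Set G) (x : G) : ℕ :=
  sInf {n : ℕ | ∃ l : List G, (∀ s ∈ l, s ∈ S) ∧ l.prod = x ∧ l.length = n}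

/-- The set `{ψ(s) | s ∈ S ∪ S⁻¹, ψ ∈ Aut(G)}`. -/
def autOrbit {G : Type u} [Group G] (S : Set G) : Set G :=
  {g | ∃ ψ : MulAut G, ∃ s : G, (s ∈ S ∨ s⁻¹ ∈ S) ∧ g = ψ s}

/-- `N` is one of the (mutually bi-Lipschitz equivalent) norms that represent the Aut-norm of `G`:
the word norm of a generating set consisting of the `Aut(G)`-orbits of the elements of a finite set
and of their inverses. -/
def IsAutNorm {G : Type u} [Group G] (N : G → ℕ) : Prop :=
  ∃ S : Set G, S.Finite ∧ Subgroup.closure (autOrbit S) = ⊤ ∧ N = wordNorm (autOrbit S)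

/-- An element of a free group is primitive if it belongs to some free basis. -/
def IsPrimitive {F : Type u} [Group F] (p : F) : Prop :=
  ∃ (ι : Type u) (B : FreeGroupBasis ι F) (i : ι), B i = p

/-- The primitive norm. -/
noncomputable def primitiveNorm {F : Type u} [Group F] (x : F) : ℕ :=
  wordNorm {p : F | IsPrimitive p} x

/-- The subgroup `⟨x⟩` is bounded in the norm `N`. -/
def IsBoundedIn {G : Type u} [Group G] (N : G → ℕ) (x : G) : Prop :=
  ∃ C : ℕ, ∀ y ∈ Subgroup.zpowers x, N y ≤ C

/-- `x` is undistorted with respect to `N`: the norm of `x ^ n` grows at least linearly. -/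
def IsUndistorted {G : Type u} [Group G] (N : G → ℕ) (x : G) : Prop :=
  ∃ C : ℝ, 0 < C ∧ ∀ n : ℕ, 0 < n → C * (n : ℝ) < (N (x ^ n) : ℝ)

/-- `H` is a free factor of `F`: the group `F` is the internal free product of `H` and of some
subgroup `K`. -/
def IsFreeFactor {F : Type u} [Group F] (H : Subgroup F) : Prop :=
  ∃ K : Subgroup F, Function.Bijective (Monoid.Coprod.lift H.subtype K.subtype)

/-- `x` is separable: it is conjugate into a proper free factor. -/
def IsSeparable {F : Type u} [Group F] (x : F) : Prop :=
  ∃ H : Subgroup F, IsFreeFactor H ∧ H ≠ ⊤ ∧ ∃ g : F, g * x * g⁻¹ ∈ H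

/-- Quasimorphisms. -/
def IsQuasimorphism {G : Type u} [Group G] (q : G → ℝ) : Prop :=
  ∃ D : ℝ, ∀ a b : G, |q a - q (a * b) + q b| < D

/-- Homogeneous quasimorphisms. -/
def IsHomogeneousQuasimorphism {G : Type u} [Group G] (q : G → ℝ) : Prop :=
  IsQuasimorphism q ∧ ∀ (x : G) (n : ℤ), q (x ^ n) = (n : ℝ) * q x

/-- `r` is the homogenization of `q`, that is, `r a = lim q (a ^ n) / n` for all `a`. -/
def IsHomogenization {G : Type u} [Group G] (q r : G → ℝ) : Prop :=
  ∀ a : G, Filter.Tendsto (fun n : ℕ => q (a ^ n) / (n : ℝ)) Filter.atTop (nhds (r a))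

open Classical in
/-- The reduced word that expresses `x` in the free basis `B`. -/
noncomputable def reducedWord {F : Type u} [Group F] {ι : Type u} (B : FreeGroupBasis ι F) (x : F) :
    List (ι × Bool) :=
  (B.repr x).toWord

open Classical in
/-- The number of (possibly overlapping) occurrences of the word `w` as a subword of `l`, counted
by the positions where they start. -/
noncomputable def occurrences {α : Type u} (w l : List α) : ℕ :=
  l.tails.countP (fun t => decide (w <+: t))

/-- The Brooks counting function `Br_w(x) = C_w(x) - C_w(x⁻¹)` with respect to the basis `B`. -/
noncomputable def brooks {F : Type u} [Group F] {ι : Type u} (B : FreeGroupBasis ι F) (w x : F) : ℝ :=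
  (occurrences (reducedWord B w) (reducedWord B x) : ℝ) -
    (occurrences (reducedWord B w) (reducedWord B x⁻¹) : ℝ)

end AutNorm

namespace AutNorm

universe u

/-! ### Word norms and automorphism orbits -/

section WordNorm

variable {G : Type u} [Group G] {S T : Set G}

/-! If `x` is conjugate into the subgroup generated by a basis without one element `b`, then, up to
conjugation, `x ^ n = (x ^ n * b) * b⁻¹` is a product of two primitive elements. All primitive
elements lie in one automorphism orbit, so bounds in the primitive norm pass to every Aut-norm.

If `x` is not separable, choose a basis in which `x` has the least length. Then `x` is cyclically
reduced and involves every generator, so the rank is finite. The Brooks function of `x ^ 2` is a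
quasimorphism. Its homogenization `q` satisfies `q x ≥ 1`, since `x ^ n` contains `n - 1` copies of
`x ^ 2` while `x ^ (-n)` contains none. A homogeneous quasimorphism that is bounded on primitive
elements grows at most linearly in the primitive norm, whence `x` is undistorted there, and then in
every Aut-norm.

It remains to bound `q` on primitive elements. Rank one is direct. In higher rank `q` vanishes on
them, because `x ^ 2` is not a subword of any power of a cyclically reduced primitive `c`
(`not_sq_infix_of_isPrimitive`). This rests on two facts about Whitehead graphs, whose vertices are
the letters and whose edges join `a⁻¹` to `z` for cyclically consecutive letters `a`, `z`. (1) The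
graph of a primitive `c` is disconnected or has a cut vertex (`AlmostInvariant.exists_cut`). In a
basis containing `c`, the elements whose word begins with another basis element form an almost
invariant set, fixed by right multiplication by `c`. Seen in the minimal basis, this set splits the
tree at some vertex. (2) If the graph of `x` had such a cut, a Whitehead automorphism would shorten
`x` (`false_of_minimal_of_cut`). If `x ^ 2` occurred in a power of `c`, every edge of the graph of
`x` would be an edge of the graph of `c`, and the cut would pass to `x`, against minimality. -/

theorem wordNorm_le_of_prod_eq {x : G} (l : List G) (h : ∀ s ∈ l, s ∈ S) (hl : l.prod = x) :
    wordNorm S x ≤ l.length :=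
  Nat.sInf_le ⟨l, h, hl, rfl⟩

theorem exists_list_prod_eq (hinv : ∀ s ∈ S, s⁻¹ ∈ S) (htop : Subgroup.closure S = ⊤) (x : G) :
    ∃ l : List G, (∀ s ∈ l, s ∈ S) ∧ l.prod = x := by
  have hx : x ∈ (Subgroup.closure S).toSubmonoid := by simp [htop]
  rw [Subgroup.closure_toSubmonoid] at hx
  obtain ⟨l, hl, hx⟩ := Submonoid.exists_list_of_mem_closure hx
  refine ⟨l, fun s hs => ?_, hx⟩
  rcases hl s hs with h | h
  · exact h
  · simpa using hinv _ h

theorem exists_list_length_eq_wordNorm (hS : ∀ x : G, ∃ l : List G, (∀ s ∈ l, s ∈ S) ∧ l.prod = x)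
    (x : G) : ∃ l : List G, (∀ s ∈ l, s ∈ S) ∧ l.prod = x ∧ l.length = wordNorm S x := by
  obtain ⟨l, hl, hx⟩ := hS x
  exact Nat.sInf_mem (s := {n : ℕ | ∃ l : List G, (∀ s ∈ l, s ∈ S) ∧ l.prod = x ∧ l.length = n})
    ⟨_, l, hl, hx, rfl⟩

theorem wordNorm_mul_le (hS : ∀ x : G, ∃ l : List G, (∀ s ∈ l, s ∈ S) ∧ l.prod = x) (x y : G) :
    wordNorm S (x * y) ≤ wordNorm S x + wordNorm S y := by
  obtain ⟨l, hl, rfl, h⟩ := exists_list_length_eq_wordNorm hS x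
  obtain ⟨m, hm, rfl, h'⟩ := exists_list_length_eq_wordNorm hS y
  rw [← h, ← h', ← List.length_append]
  refine wordNorm_le_of_prod_eq _ (fun s hs => ?_) (by simp)
  rcases List.mem_append.1 hs with hs | hs
  exacts [hl s hs, hm s hs]

theorem wordNorm_map_le (hS : ∀ x : G, ∃ l : List G, (∀ s ∈ l, s ∈ S) ∧ l.prod = x)
    (ψ : MulAut G) (hψ : ∀ s ∈ S, ψ s ∈ S) (x : G) : wordNorm S (ψ x) ≤ wordNorm S x := by
  obtain ⟨l, hl, rfl, h⟩ := exists_list_length_eq_wordNorm hS x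
  rw [← h, ← List.length_map (as := l) ψ]
  refine wordNorm_le_of_prod_eq _ (fun s hs => ?_) (by simp [map_list_prod])
  obtain ⟨t, ht, rfl⟩ := List.mem_map.1 hs
  exact hψ t (hl t ht)

theorem wordNorm_one : wordNorm S (1 : G) = 0 :=
  Nat.le_zero.1 (wordNorm_le_of_prod_eq [] (by simp) rfl)

theorem wordNorm_le_mul (hS : ∀ x : G, ∃ l : List G, (∀ s ∈ l, s ∈ S) ∧ l.prod = x)
    (hT : ∀ x : G, ∃ l : List G, (∀ s ∈ l, s ∈ T) ∧ l.prod = x) {M : ℕ}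
    (hM : ∀ s ∈ S, wordNorm T s ≤ M) (x : G) : wordNorm T x ≤ M * wordNorm S x := by
  obtain ⟨l, hl, rfl, h⟩ := exists_list_length_eq_wordNorm hS x
  rw [← h]
  clear h
  induction l with
  | nil => simp [wordNorm_one]
  | cons a l ih =>
    have h1 := hM a (hl a (by simp))
    have h2 := ih (fun s hs => hl s (by simp [hs]))
    have h3 := wordNorm_mul_le hT a l.prod
    simp only [List.prod_cons, List.length_cons]
    linarith [Nat.mul_succ M l.length]

theorem inv_mem_autOrbit {g : G} (hg : g ∈ autOrbit S) : g⁻¹ ∈ autOrbit S := by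
  obtain ⟨ψ, s, hs, rfl⟩ := hg
  exact ⟨ψ, s⁻¹, by rw [inv_inv]; exact hs.symm, by simp⟩

theorem map_mem_autOrbit (φ : MulAut G) {g : G} (hg : g ∈ autOrbit S) : φ g ∈ autOrbit S := by
  obtain ⟨ψ, s, hs, rfl⟩ := hg
  exact ⟨φ * ψ, s, hs, by simp⟩

theorem exists_list_autOrbit_prod_eq {S : Set G} (hS : Subgroup.closure (autOrbit S) = ⊤) (x : G) :
    ∃ l : List G, (∀ s ∈ l, s ∈ autOrbit S) ∧ l.prod = x :=
  exists_list_prod_eq (fun _ h => inv_mem_autOrbit h) hS x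

end WordNorm

/-! ### Primitive elements -/

section Primitive

variable {F : Type u} [Group F]

theorem IsPrimitive.map {p : F} (hp : IsPrimitive p) (ψ : MulAut F) : IsPrimitive (ψ p) := by
  obtain ⟨ι, B, i, rfl⟩ := hp
  exact ⟨ι, B.map ψ, i, by simp⟩

theorem IsPrimitive.conj {p : F} (hp : IsPrimitive p) (g : F) : IsPrimitive (g * p * g⁻¹) := by
  simpa using hp.map (MulAut.conj g)

open Classical in
/-- The automorphism of a free group that inverts the generator `i`. -/
noncomputable def invGenerator {ι : Type u} (i : ι) : FreeGroup ι ≃* FreeGroup ι :=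
  MonoidHom.toMulEquiv
    (FreeGroup.lift fun j => if j = i then (FreeGroup.of j)⁻¹ else FreeGroup.of j)
    (FreeGroup.lift fun j => if j = i then (FreeGroup.of j)⁻¹ else FreeGroup.of j)
    (by ext j; by_cases h : j = i <;> simp [h])
    (by ext j; by_cases h : j = i <;> simp [h])

theorem IsPrimitive.inv {p : F} (hp : IsPrimitive p) : IsPrimitive p⁻¹ := by
  obtain ⟨ι, B, i, rfl⟩ := hp
  have h := IsPrimitive.map ⟨ι, B, i, rfl⟩ ((B.repr.trans (invGenerator i)).trans B.repr.symm)
  convert h using 1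
  have h1 : invGenerator i (FreeGroup.of i) = (FreeGroup.of i)⁻¹ := by
    simp [invGenerator]
  simp only [MulEquiv.trans_apply, FreeGroupBasis.repr_apply_coe, h1, map_inv]
  rfl

theorem lift_eq_self_of_mem_closure {ι : Type u} {f : ι → FreeGroup ι} {s : Set ι}
    (hf : ∀ j ∈ s, f j = FreeGroup.of j) {h : FreeGroup ι}
    (hh : h ∈ Subgroup.closure (FreeGroup.of '' s)) : FreeGroup.lift f h = h := by
  refine MonoidHom.eqOn_closure (f := FreeGroup.lift f) (g := MonoidHom.id _) ?_ hh
  rintro _ ⟨j, hj, rfl⟩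
  simp [hf j hj]

open Classical in
/-- The automorphism of a free group that multiplies the generator `i` from the left by an element
of the subgroup generated by the other generators. -/
noncomputable def mulGenerator {ι : Type u} (i : ι) (h : FreeGroup ι)
    (hh : h ∈ Subgroup.closure (FreeGroup.of '' {i}ᶜ)) : FreeGroup ι ≃* FreeGroup ι :=
  MonoidHom.toMulEquiv
    (FreeGroup.lift fun j => if j = i then h * FreeGroup.of j else FreeGroup.of j)
    (FreeGroup.lift fun j => if j = i then h⁻¹ * FreeGroup.of j else FreeGroup.of j)
    (by
      ext j
      by_cases hj : j = i
      · simp only [MonoidHom.comp_apply, FreeGroup.lift_apply_of, hj, if_true, map_mul,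
          MonoidHom.id_apply]
        rw [lift_eq_self_of_mem_closure (fun j hj => by simp_all) hh]
        simp
      · simp [hj])
    (by
      ext j
      by_cases hj : j = i
      · simp only [MonoidHom.comp_apply, FreeGroup.lift_apply_of, hj, if_true, map_mul,
          MonoidHom.id_apply, map_inv]
        rw [lift_eq_self_of_mem_closure (fun j hj => by simp_all) hh]
        simp
      · simp [hj])

theorem map_repr_mem_closure {ι : Type u} (B : FreeGroupBasis ι F) {s : Set ι} {h : F}
    (hh : h ∈ Subgroup.closure (B '' s)) :
    B.repr h ∈ Subgroup.closure (FreeGroup.of '' s) := by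
  have h1 := Subgroup.mem_map_of_mem B.repr.toMonoidHom hh
  rw [MonoidHom.map_closure, Set.image_image] at h1
  simpa using h1

theorem isPrimitive_mul {ι : Type u} (B : FreeGroupBasis ι F) (i : ι) {h : F}
    (hh : h ∈ Subgroup.closure (B '' {i}ᶜ)) : IsPrimitive (h * B i) := by
  have h2 := IsPrimitive.map ⟨ι, B, i, rfl⟩
    ((B.repr.trans (mulGenerator i _ (map_repr_mem_closure B hh))).trans B.repr.symm)
  convert h2 using 1
  have h1 : mulGenerator i _ (map_repr_mem_closure B hh) (FreeGroup.of i) =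
      B.repr h * FreeGroup.of i := by
    simp [mulGenerator]
  simp only [MulEquiv.trans_apply, FreeGroupBasis.repr_apply_coe, h1, map_mul,
    MulEquiv.symm_apply_apply]
  rfl

open Classical in
theorem IsPrimitive.exists_mulAut {p p' : F} (hp : IsPrimitive p) (hp' : IsPrimitive p') :
    ∃ ψ : MulAut F, ψ p = p' := by
  obtain ⟨ι, B, i, rfl⟩ := hp
  obtain ⟨ι', B', i', rfl⟩ := hp'
  let e : ι ≃ ι' := Equiv.ofFreeGroupEquiv (B.repr.symm.trans B'.repr)
  -- The ranks agree, which gives some bijection of the index sets; the swap makes it send `i` to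
  -- `i'`.
  let e' : ι ≃ ι' := e.trans (Equiv.swap (e i) i')
  refine ⟨(B.repr.trans (FreeGroup.freeGroupCongr e')).trans B'.repr.symm, ?_⟩
  simp only [MulEquiv.trans_apply, FreeGroupBasis.repr_apply_coe]
  have : FreeGroup.freeGroupCongr e' (FreeGroup.of i) = FreeGroup.of i' := by simp [e']
  rw [this]
  rfl

theorem closure_range_basis {ι : Type u} (B : FreeGroupBasis ι F) :
    Subgroup.closure (Set.range B) = ⊤ := by
  have h1 := congrArg (Subgroup.map B.repr.symm.toMonoidHom) (FreeGroup.closure_range_of ι)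
  rw [MonoidHom.map_closure, ← Set.range_comp] at h1
  rw [Subgroup.map_top_of_surjective _ B.repr.symm.surjective] at h1
  exact h1

theorem exists_list_isPrimitive_prod_eq [IsFreeGroup F] (x : F) :
    ∃ l : List F, (∀ p ∈ l, p ∈ {p : F | IsPrimitive p}) ∧ l.prod = x := by
  refine exists_list_prod_eq (S := {p : F | IsPrimitive p}) (fun p hp => IsPrimitive.inv hp) ?_ x
  rw [eq_top_iff, ← closure_range_basis (IsFreeGroup.basis F)]
  apply Subgroup.closure_mono
  rintro _ ⟨i, rfl⟩
  exact ⟨_, _, i, rfl⟩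

end Primitive

/-! ### Separability in terms of bases -/

section Separable

variable {F : Type u} [Group F]

open Classical in
theorem isFreeFactor_closure_compl_singleton {ι : Type u} (B : FreeGroupBasis ι F) (i : ι) :
    IsFreeFactor (Subgroup.closure (B '' {i}ᶜ)) := by
  set H := Subgroup.closure (B '' {i}ᶜ) with hH
  set K := Subgroup.closure (B '' {i}) with hK
  have hmH : ∀ j, j ≠ i → B j ∈ H := fun j hj => Subgroup.subset_closure ⟨j, hj, rfl⟩
  have hmK : B i ∈ K := Subgroup.subset_closure ⟨i, rfl, rfl⟩
  let f : F →* Monoid.Coprod H K := B.lift fun j =>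
    if hj : j = i then Monoid.Coprod.inr ⟨B i, hmK⟩ else Monoid.Coprod.inl ⟨B j, hmH j hj⟩
  have hf : ∀ j, f (B j) = if hj : j = i then Monoid.Coprod.inr ⟨B i, hmK⟩ else
      Monoid.Coprod.inl ⟨B j, hmH j hj⟩ := fun j => by simp [f]
  have h1 : (Monoid.Coprod.lift H.subtype K.subtype).comp f = MonoidHom.id F := by
    refine B.ext_hom _ _ fun j => ?_
    by_cases hj : j = i
    · subst hj; simp [hf]
    · simp [hf, hj]
  have h2 : f.comp (Monoid.Coprod.lift H.subtype K.subtype) = MonoidHom.id _ := by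
    refine Monoid.Coprod.hom_ext ?_ ?_
    · ext ⟨h, hh⟩
      simp only [MonoidHom.comp_apply, Monoid.Coprod.lift_apply_inl, Subgroup.subtype_apply,
        MonoidHom.id_apply]
      induction hh using Subgroup.closure_induction with
      | mem y hy =>
        obtain ⟨j, hj, rfl⟩ := hy
        have hj' : j ≠ i := hj
        simp [hf, hj']
      | one => rw [map_one]; exact (map_one Monoid.Coprod.inl).symm
      | mul a b ha hb iha ihb => rw [map_mul, iha, ihb, ← map_mul]; rfl
      | inv a ha iha => rw [map_inv, iha, ← map_inv]; rfl
    · ext ⟨h, hh⟩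
      simp only [MonoidHom.comp_apply, Monoid.Coprod.lift_apply_inr, Subgroup.subtype_apply,
        MonoidHom.id_apply]
      induction hh using Subgroup.closure_induction with
      | mem y hy =>
        obtain ⟨j, hj, rfl⟩ := hy
        have hj' : j = i := hj
        subst hj'
        simp [hf]
      | one => rw [map_one]; exact (map_one Monoid.Coprod.inr).symm
      | mul a b ha hb iha ihb => rw [map_mul, iha, ihb, ← map_mul]; rfl
      | inv a ha iha => rw [map_inv, iha, ← map_inv]; rfl
  exact ⟨K, (MonoidHom.toMulEquiv _ f h2 h1).bijective⟩

open Classical in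
theorem closure_compl_singleton_ne_top {ι : Type u} (B : FreeGroupBasis ι F) (i : ι) :
    Subgroup.closure (B '' {i}ᶜ) ≠ ⊤ := by
  intro h
  let f : F →* Multiplicative ℤ := B.lift fun j => if j = i then Multiplicative.ofAdd 1 else 1
  have h1 : Subgroup.closure (B '' {i}ᶜ) ≤ f.ker := by
    rw [Subgroup.closure_le]
    rintro _ ⟨j, hj, rfl⟩
    have hj' : j ≠ i := hj
    simp [f, MonoidHom.mem_ker, hj']
  have h2 : B i ∈ f.ker := h1 (h ▸ Subgroup.mem_top _)
  simp [f, MonoidHom.mem_ker] at h2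

theorem isSeparable_of_mem_closure {ι : Type u} (B : FreeGroupBasis ι F) (i : ι) {x : F}
    (h : x ∈ Subgroup.closure (B '' {i}ᶜ)) : IsSeparable x :=
  ⟨_, isFreeFactor_closure_compl_singleton B i, closure_compl_singleton_ne_top B i, 1, by simpa⟩

/-- Subgroups of free groups are free, so bases of the two factors unite to a basis of `F`. The
second factor is nontrivial because the first is proper, and any of its basis elements can serve as
the omitted one. -/
theorem IsSeparable.exists_basis [IsFreeGroup F] {x : F} (hx : IsSeparable x) :
    ∃ (ι : Type u) (B : FreeGroupBasis ι F) (i : ι) (g : F),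
      g * x * g⁻¹ ∈ Subgroup.closure (B '' {i}ᶜ) := by
  obtain ⟨H, ⟨K, hHK⟩, hH, g, hg⟩ := hx
  let BH := IsFreeGroup.basis H
  let BK := IsFreeGroup.basis K
  let e : Monoid.Coprod H K ≃* F := MulEquiv.ofBijective _ hHK
  let E : Monoid.Coprod H K ≃*
      FreeGroup (IsFreeGroup.Generators H ⊕ IsFreeGroup.Generators K) :=
    MonoidHom.toMulEquiv
      (Monoid.Coprod.lift (BH.lift fun a => FreeGroup.of (Sum.inl a))
        (BK.lift fun b => FreeGroup.of (Sum.inr b)))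
      (FreeGroup.lift
        (Sum.elim (fun a => Monoid.Coprod.inl (BH a)) (fun b => Monoid.Coprod.inr (BK b))))
      (by
        refine Monoid.Coprod.hom_ext ?_ ?_
        · refine BH.ext_hom _ _ fun a => ?_
          simp
        · refine BK.ext_hom _ _ fun a => ?_
          simp)
      (by
        ext (a | b)
        · simp
        · simp)
  let B : FreeGroupBasis _ F := FreeGroupBasis.ofRepr (e.symm.trans E)
  have hBl : ∀ a, B (Sum.inl a) = BH a := fun a => by
    change e (E.symm (FreeGroup.of (Sum.inl a))) = _
    simp [E, e]
  have hne : Nonempty (IsFreeGroup.Generators K) := by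
    by_contra hempty
    rw [not_nonempty_iff] at hempty
    apply hH
    rw [eq_top_iff]
    intro y _
    obtain ⟨z, rfl⟩ := hHK.surjective y
    induction z using Monoid.Coprod.induction_on with
    | inl h => simp
    | inr k =>
      have : k = 1 := BK.repr.injective (Subsingleton.elim _ _)
      simp [this]
    | mul a b ha hb => rw [map_mul]; exact H.mul_mem (ha trivial) (hb trivial)
  obtain ⟨b⟩ := hne
  refine ⟨_, B, Sum.inr b, g, ?_⟩
  have hle : ∀ h : H, (h : F) ∈ Subgroup.closure (B '' {Sum.inr b}ᶜ) := by
    intro h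
    have hh : h ∈ Subgroup.closure (Set.range BH) := by rw [closure_range_basis]; trivial
    induction hh using Subgroup.closure_induction with
    | mem y hy =>
      obtain ⟨a, rfl⟩ := hy
      exact Subgroup.subset_closure ⟨Sum.inl a, by simp, hBl a⟩
    | one => exact Subgroup.one_mem _
    | mul a b _ _ iha ihb => exact Subgroup.mul_mem _ iha ihb
    | inv a _ iha => exact Subgroup.inv_mem _ iha
  exact hle ⟨_, hg⟩

end Separable

/-! ### Comparison of the primitive norm with Aut-norms -/

section Bounded

variable {F : Type u} [Group F] [IsFreeGroup F]

theorem IsSeparable.primitiveNorm_zpow_le {x : F} (hx : IsSeparable x) (n : ℤ) :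
    primitiveNorm (x ^ n) ≤ 2 := by
  obtain ⟨ι, B, i, g, h⟩ := hx.exists_basis
  have h1 : IsPrimitive ((g * x * g⁻¹) ^ n * B i) := isPrimitive_mul B i (Subgroup.zpow_mem _ h n)
  have h2 : IsPrimitive (B i)⁻¹ := IsPrimitive.inv ⟨_, B, i, rfl⟩
  have h3 := h1.conj g⁻¹
  have h4 := h2.conj g⁻¹
  refine wordNorm_le_of_prod_eq (S := {p : F | IsPrimitive p})
    [g⁻¹ * ((g * x * g⁻¹) ^ n * B i) * g⁻¹⁻¹, g⁻¹ * (B i)⁻¹ * g⁻¹⁻¹] ?_ ?_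
  · intro s hs
    simp only [List.mem_cons, List.not_mem_nil, or_false] at hs
    rcases hs with rfl | rfl
    exacts [h3, h4]
  · rw [conj_zpow]
    simp only [List.prod_cons, List.prod_nil]
    group

theorem IsSeparable.isBoundedIn {x : F} (hx : IsSeparable x) {N : F → ℕ} (hN : IsAutNorm N) :
    IsBoundedIn N x := by
  obtain ⟨S, -, htop, rfl⟩ := hN
  have hS := exists_list_autOrbit_prod_eq htop
  obtain ⟨ι, B, i, -, -⟩ := hx.exists_basis
  refine ⟨wordNorm (autOrbit S) (B i) * 2, ?_⟩
  rintro _ ⟨n, rfl⟩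
  -- One constant serves for all primitive elements, since each is an automorphic image of `B i`.
  refine (wordNorm_le_mul exists_list_isPrimitive_prod_eq hS (M := wordNorm (autOrbit S) (B i))
    (fun p hp => ?_) _).trans (Nat.mul_le_mul_left _ (hx.primitiveNorm_zpow_le n))
  obtain ⟨ψ, rfl⟩ := IsPrimitive.exists_mulAut ⟨_, B, i, rfl⟩ hp
  exact wordNorm_map_le hS ψ (fun s hs => map_mem_autOrbit ψ hs) _

theorem isUndistorted_of_isUndistorted_primitiveNorm {x : F} (hx : IsUndistorted primitiveNorm x)
    {N : F → ℕ} (hN : IsAutNorm N) : IsUndistorted N x := by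
  obtain ⟨S, hfin, htop, rfl⟩ := hN
  have hS := exists_list_autOrbit_prod_eq htop
  obtain ⟨C, hC, h⟩ := hx
  obtain ⟨M, hM⟩ : ∃ M : ℕ, ∀ s ∈ S ∪ (fun s => s⁻¹) '' S, primitiveNorm s ≤ M := by
    obtain ⟨M, hM⟩ := ((hfin.union (hfin.image _)).image primitiveNorm).bddAbove
    exact ⟨M, fun s hs => hM ⟨s, hs, rfl⟩⟩
  have hle : ∀ y : F, primitiveNorm y ≤ (M + 1) * wordNorm (autOrbit S) y := by
    refine wordNorm_le_mul hS exists_list_isPrimitive_prod_eq ?_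
    rintro _ ⟨ψ, s, hs, rfl⟩
    refine (wordNorm_map_le exists_list_isPrimitive_prod_eq ψ (fun p hp => IsPrimitive.map hp ψ)
      s).trans ((hM s ?_).trans (Nat.le_succ M))
    rcases hs with hs | hs
    exacts [Or.inl hs, Or.inr ⟨s⁻¹, hs, inv_inv s⟩]
  refine ⟨C / (M + 1), by positivity, fun n hn => ?_⟩
  have h1 := h n hn
  have h2 : (primitiveNorm (x ^ n) : ℝ) ≤ (M + 1) * (wordNorm (autOrbit S) (x ^ n) : ℝ) := by
    exact_mod_cast hle (x ^ n)
  rw [div_mul_eq_mul_div, div_lt_iff₀ (by positivity)]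
  linarith

end Bounded

end AutNorm

namespace AutNorm

universe u

/-! ### Homogenization of quasimorphisms -/

section Quasimorphism

variable {G : Type u} [Group G] {q r : G → ℝ} {D : ℝ}

theorem abs_map_pow_sub_le (hq : ∀ a b, |q a - q (a * b) + q b| ≤ D) (a : G) (n : ℕ) :
    |q (a ^ (n + 1)) - (n + 1) * q a| ≤ n * D := by
  induction n with
  | zero => simp
  | succ n ih =>
    have h := hq (a ^ (n + 1)) a
    rw [← pow_succ] at h
    rw [abs_le] at *
    push_cast
    constructor <;> linarith

/-- Fekete's lemma: adding the defect `D` makes `n ↦ q (a ^ n)` subadditive, and the linear bound on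
its deviation from `n * q a` keeps the quotients bounded below. -/
theorem exists_homogenization (hq : ∀ a b, |q a - q (a * b) + q b| ≤ D) :
    ∃ r : G → ℝ, IsHomogenization q r ∧ ∀ a, |r a - q a| ≤ D := by
  have hD : 0 ≤ D := (abs_nonneg _).trans (hq 1 1)
  have hdiv : ∀ (a : G) (n : ℕ), 0 < n → |q (a ^ n) / n - q a| ≤ D := by
    intro a n hn
    obtain ⟨m, rfl⟩ := Nat.exists_eq_add_of_lt hn
    have h := abs_map_pow_sub_le hq a m
    rw [zero_add]
    have hm : (0 : ℝ) < (m : ℝ) + 1 := by positivity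
    have : q (a ^ (m + 1)) / ((m + 1 : ℕ) : ℝ) - q a =
        (q (a ^ (m + 1)) - (m + 1) * q a) / (m + 1) := by
      push_cast; field_simp
    rw [this, abs_div, abs_of_pos hm, div_le_iff₀ hm]
    nlinarith
  have hlim : ∀ a : G, ∃ L : ℝ,
      Filter.Tendsto (fun n : ℕ => q (a ^ n) / (n : ℝ)) Filter.atTop (nhds L) := by
    intro a
    have hsub : Subadditive fun n : ℕ => q (a ^ n) + D := by
      intro m n
      have := (abs_le.1 (hq (a ^ m) (a ^ n))).1
      rw [← pow_add] at this
      linarith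
    have hbdd : BddBelow (Set.range fun n : ℕ => (q (a ^ n) + D) / (n : ℝ)) := by
      refine ⟨min 0 (q a - D), ?_⟩
      rintro _ ⟨n, rfl⟩
      rcases Nat.eq_zero_or_pos n with rfl | hn
      · simp
      · refine (min_le_right _ _).trans ?_
        have h1 := (abs_le.1 (hdiv a n hn)).1
        have h2 : 0 ≤ D / (n : ℝ) := by positivity
        simp only [add_div]
        linarith
    have h1 := hsub.tendsto_lim hbdd
    have h2 := tendsto_const_div_atTop_nhds_zero_nat D
    refine ⟨_, (h1.sub h2).congr fun n => ?_⟩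
    ring
  choose r hr using hlim
  refine ⟨r, hr, fun a => ?_⟩
  refine le_of_tendsto ((hr a).sub_const (q a)).abs ?_
  filter_upwards [Filter.eventually_gt_atTop 0] with n hn using hdiv a n hn

theorem IsHomogenization.map_pow (h : IsHomogenization q r) (a : G) (k : ℕ) :
    r (a ^ k) = k * r a := by
  rcases Nat.eq_zero_or_pos k with rfl | hk
  · refine tendsto_nhds_unique (h (a ^ 0)) ?_
    simpa using tendsto_const_div_atTop_nhds_zero_nat (q 1)
  · refine tendsto_nhds_unique (h (a ^ k)) ?_
    have h1 : Filter.Tendsto (fun n : ℕ => k * n) Filter.atTop Filter.atTop :=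
      Filter.tendsto_id.const_mul_atTop' hk
    refine (((h a).comp h1).const_mul (k : ℝ)).congr fun n => ?_
    have : (k : ℝ) ≠ 0 := by positivity
    simp only [Function.comp_apply, Nat.cast_mul, pow_mul]
    field_simp

theorem IsHomogenization.map_inv (h : IsHomogenization q r) (hinv : ∀ a, q a⁻¹ = -q a) (a : G) :
    r a⁻¹ = -r a := by
  refine tendsto_nhds_unique (h a⁻¹) ((h a).neg.congr fun n => ?_)
  rw [inv_pow, hinv, neg_div]

theorem IsHomogenization.isHomogeneousQuasimorphism (h : IsHomogenization q r)
    (hinv : ∀ a, q a⁻¹ = -q a) (hq : ∀ a b, |q a - q (a * b) + q b| ≤ D)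
    (hr : ∀ a, |r a - q a| ≤ D) : IsHomogeneousQuasimorphism r := by
  -- The defect of `q` and three replacements of `q` by `r` cost `D` each; the 1 makes the
  -- inequality strict.
  refine ⟨⟨4 * D + 1, fun a b => ?_⟩, fun a n => ?_⟩
  · have h1 := abs_le.1 (hr a)
    have h2 := abs_le.1 (hr b)
    have h3 := abs_le.1 (hr (a * b))
    have h4 := abs_le.1 (hq a b)
    rw [abs_lt]
    constructor <;> linarith
  · obtain ⟨k, rfl | rfl⟩ := n.eq_nat_or_neg
    · simpa using h.map_pow a k
    · rw [zpow_neg, h.map_inv hinv, zpow_natCast, h.map_pow]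
      push_cast
      ring

/-- The values at the `n`th powers of two conjugates differ by at most twice the defect, whereas
homogeneity multiplies their difference by `n`. -/
theorem IsHomogeneousQuasimorphism.map_conj (h : IsHomogeneousQuasimorphism r) (g a : G) :
    r (g * a * g⁻¹) = r a := by
  obtain ⟨⟨D, hD⟩, hpow⟩ := h
  have hg : r g⁻¹ = -r g := by simpa using hpow g (-1)
  have hbound : ∀ n : ℕ, (n : ℝ) * |r (g * a * g⁻¹) - r a| ≤ 2 * D := by
    intro n
    have h1 := hD (g * a ^ n) g⁻¹
    have h2 := hD g (a ^ n)
    have h3 := hpow (g * a * g⁻¹) n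
    have h4 := hpow a n
    rw [zpow_natCast, conj_pow] at h3
    rw [zpow_natCast] at h4
    rw [h3] at h1
    rw [h4] at h2
    rw [hg] at h1
    rw [abs_lt] at h1 h2
    have h5 : (n : ℝ) * |r (g * a * g⁻¹) - r a| = |(n : ℝ) * (r (g * a * g⁻¹) - r a)| := by
      rw [abs_mul, Nat.abs_cast]
    rw [h5, abs_le]
    push_cast at *
    constructor <;> nlinarith
  by_contra hne
  have hpos : 0 < |r (g * a * g⁻¹) - r a| := abs_pos.2 (sub_ne_zero.2 hne)
  obtain ⟨n, hn⟩ := exists_nat_gt (2 * D / |r (g * a * g⁻¹) - r a|)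
  rw [div_lt_iff₀ hpos] at hn
  linarith [hbound n]

theorem IsHomogeneousQuasimorphism.abs_map_list_prod_le (h : IsHomogeneousQuasimorphism r)
    {S : Set G} {C : ℝ} (hC : ∀ s ∈ S, |r s| ≤ C) :
    ∃ K : ℝ, 0 < K ∧ ∀ l : List G, (∀ s ∈ l, s ∈ S) → |r l.prod| ≤ K * l.length := by
  obtain ⟨⟨D, hD⟩, hpow⟩ := h
  refine ⟨|C| + |D| + 1, by positivity, fun l hl => ?_⟩
  induction l with
  | nil => simpa using hpow 1 0
  | cons a l ih =>
    have h1 := abs_le.1 (ih fun s hs => hl s (by simp [hs]))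
    have h2 := abs_le.1 (hC a (hl a (by simp)))
    have h3 := abs_lt.1 (hD a l.prod)
    have h4 := le_abs_self C
    have h5 := le_abs_self D
    simp only [List.prod_cons, List.length_cons]
    push_cast
    rw [abs_le]
    constructor <;> linarith

end Quasimorphism

/-! ### Counting subwords -/

section Occurrences

variable {α : Type u}

theorem occurrences_eq_zero_iff {w l : List α} : occurrences w l = 0 ↔ ¬ w <:+: l := by
  classical
  rw [occurrences, List.countP_eq_zero, List.infix_iff_prefix_suffix]
  simp [List.mem_tails]
  tauto

theorem occurrences_nil {w : List α} (hw : w ≠ []) : occurrences w [] = 0 := by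
  rw [occurrences_eq_zero_iff]
  simpa using hw

open Classical in
theorem occurrences_cons (w : List α) (a : α) (l : List α) :
    occurrences w (a :: l) = occurrences w l + if w <+: a :: l then 1 else 0 := by
  simp [occurrences, List.countP_cons]

theorem occurrences_add_le_append {w : List α} (hw : w ≠ []) (u v : List α) :
    occurrences w u + occurrences w v ≤ occurrences w (u ++ v) := by
  classical
  induction u with
  | nil => simp [occurrences_nil hw]
  | cons a u ih =>
    rw [List.cons_append, occurrences_cons, occurrences_cons]
    have : w <+: a :: u → w <+: a :: (u ++ v) := fun h => h.trans (List.prefix_append (a :: u) v)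
    split_ifs <;> first | omega | tauto

theorem occurrences_append_le_add (w u v : List α) :
    occurrences w (u ++ v) ≤ occurrences w u + occurrences w v + w.length := by
  classical
  -- The minimum makes the induction work: a letter of `u` at distance at least `w.length` from the
  -- junction starts no straddling occurrence.
  suffices h : occurrences w (u ++ v) ≤ occurrences w u + occurrences w v +
      min u.length w.length from h.trans (by omega)
  induction u with
  | nil => simp
  | cons a u ih =>
    rw [List.cons_append, occurrences_cons, occurrences_cons]
    have : w <+: a :: (u ++ v) → w.length ≤ u.length + 1 → w <+: a :: u := fun h hl =>
      List.prefix_of_prefix_length_le h (List.prefix_append (a :: u) v) (by simpa using hl)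
    simp only [List.length_cons]
    split_ifs <;> first | omega | (by_cases hl : w.length ≤ u.length + 1; tauto; omega)

theorem le_occurrences_replicate_flatten {X : List α} (hX : X ≠ []) (n : ℕ) :
    n ≤ occurrences (X ++ X) (List.replicate (n + 1) X).flatten := by
  classical
  induction n with
  | zero => simp
  | succ n ih =>
    obtain ⟨a, X', rfl⟩ := List.exists_cons_of_ne_nil hX
    have h2 : ((a :: X') ++ (a :: X')) <+: (List.replicate (n + 1 + 1) (a :: X')).flatten :=
      ⟨(List.replicate n (a :: X')).flatten, by simp [List.replicate_succ]⟩
    have h1 := occurrences_add_le_append (w := (a :: X') ++ (a :: X')) (by simp) X'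
      (List.replicate (n + 1) (a :: X')).flatten
    rw [List.replicate_succ, List.flatten_cons] at h2 ⊢
    rw [List.cons_append (bs := (List.replicate (n + 1) (a :: X')).flatten)] at h2 ⊢
    rw [occurrences_cons, if_pos h2]
    omega

/-- A window of one period length in a periodic word meets at most two consecutive periods. -/
theorem exists_rotation_of_infix_flatten {X Y : List α} (hXY : X.length = Y.length) (n : ℕ)
    (h : X <:+: (List.replicate n Y).flatten) : ∃ u v, Y = u ++ v ∧ X = v ++ u := by
  obtain ⟨S, T, h⟩ := h
  induction n generalizing S with
  | zero =>
    have : X = [] := by simp_all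
    subst this
    exact ⟨[], [], by simpa [eq_comm] using hXY, rfl⟩
  | succ n ih =>
    rw [List.replicate_succ, List.flatten_cons, List.append_assoc] at h
    rcases List.append_eq_append_iff.1 h with ⟨v, hY, hv⟩ | ⟨S', hS, hv⟩
    · rcases List.append_eq_append_iff.1 hv with ⟨X', hv', hX'⟩ | ⟨u, hX, hu⟩
      · have hlen : S = [] ∧ X' = [] := by
          have := congrArg List.length hY
          have h' := congrArg List.length hv'
          simp only [List.length_append] at this h'
          exact ⟨List.length_eq_zero_iff.1 (by omega), List.length_eq_zero_iff.1 (by omega)⟩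
        obtain ⟨rfl, rfl⟩ := hlen
        exact ⟨[], Y, by simp, by simp_all⟩
      · refine ⟨S, v, hY, ?_⟩
        rw [hX]
        congr 1
        have hlen : u.length = S.length := by
          rw [hX, hY] at hXY
          simp only [List.length_append] at hXY
          omega
        cases n with
        | zero =>
          have hu0 : u = [] := by simp_all
          have hS0 : S = [] := List.length_eq_zero_iff.1 (by simpa [hu0] using hlen.symm)
          rw [hu0, hS0]
        | succ n =>
          rw [List.replicate_succ, List.flatten_cons, hY, List.append_assoc] at hu
          exact (List.append_inj hu hlen.symm).1.symm
    · exact ih S' (by rw [hv, List.append_assoc])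

end Occurrences

/-! ### Brooks counting functions -/

section Brooks

open Classical FreeGroup

variable {ι : Type u}

theorem isReduced_append_of_ne {u v : List (ι × Bool)} {a b : ι × Bool}
    (hu : IsReduced (u ++ [a])) (hv : IsReduced (b :: v)) (hab : a.1 = b.1 → a.2 = b.2) :
    IsReduced (u ++ [a] ++ b :: v) := by
  unfold FreeGroup.IsReduced at *
  rw [List.isChain_append]
  refine ⟨hu, hv, ?_⟩
  simpa using hab

theorem exists_cancellation {L₁ L₂ : List (ι × Bool)} (h₁ : IsReduced L₁) (h₂ : IsReduced L₂) :
    ∃ u t v, L₁ = u ++ t ∧ L₂ = invRev t ++ v ∧ IsReduced (u ++ v) := by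
  induction L₂ generalizing L₁ with
  | nil => exact ⟨L₁, [], [], by simp, by simp, by simpa⟩
  | cons b L₂ ih =>
    rcases List.eq_nil_or_concat L₁ with rfl | ⟨L, a, rfl⟩
    · exact ⟨[], [], b :: L₂, rfl, by simp, by simpa⟩
    · rw [List.concat_eq_append] at *
      by_cases hab : a.1 = b.1 → a.2 = b.2
      · exact ⟨L ++ [a], [], b :: L₂, by simp, by simp, isReduced_append_of_ne h₁ h₂ hab⟩
      · obtain ⟨u, t, v, rfl, rfl, h⟩ := ih (L₁ := L) (h₁.infix ⟨[], [a], by simp⟩)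
          (h₂.infix ⟨[b], [], by simp⟩)
        refine ⟨u, t ++ [a], v, by simp, ?_, h⟩
        obtain ⟨i, x⟩ := a
        obtain ⟨j, y⟩ := b
        simp only [Classical.not_imp] at hab
        obtain ⟨rfl, hxy⟩ := hab
        have : y = !x := by cases x <;> cases y <;> simp_all
        simp [invRev, this]

theorem exists_toWord_mul (g h : FreeGroup ι) :
    ∃ u t v, g.toWord = u ++ t ∧ h.toWord = invRev t ++ v ∧ (g * h).toWord = u ++ v := by
  obtain ⟨u, t, v, h1, h2, h3⟩ := exists_cancellation (isReduced_toWord (x := g))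
    (isReduced_toWord (x := h))
  refine ⟨u, t, v, h1, h2, ?_⟩
  rw [← h3.reduce_eq, ← toWord_mk]
  congr 1
  rw [← mk_toWord (x := g), ← mk_toWord (x := h), h1, h2, ← mul_mk, ← mul_mk, ← mul_mk, ← inv_mk]
  group

/-- The signed count of the word `w` in the word `l`. -/
noncomputable def signedCount (w l : List (ι × Bool)) : ℝ :=
  (occurrences w l : ℝ) - (occurrences w (invRev l) : ℝ)

theorem signedCount_invRev (w l : List (ι × Bool)) :
    signedCount w (invRev l) = -signedCount w l := by
  simp [signedCount]

theorem abs_signedCount_append_le {w : List (ι × Bool)} (hw : w ≠ []) (u v : List (ι × Bool)) :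
    |signedCount w (u ++ v) - signedCount w u - signedCount w v| ≤ w.length := by
  have h1 : (occurrences w u : ℝ) + occurrences w v ≤ occurrences w (u ++ v) := by
    exact_mod_cast occurrences_add_le_append hw u v
  have h2 : (occurrences w (u ++ v) : ℝ) ≤ occurrences w u + occurrences w v + w.length := by
    exact_mod_cast occurrences_append_le_add w u v
  have h3 : (occurrences w (invRev v) : ℝ) + occurrences w (invRev u) ≤
      occurrences w (invRev (u ++ v)) := by
    rw [invRev_append]
    exact_mod_cast occurrences_add_le_append hw _ _
  have h4 : (occurrences w (invRev (u ++ v)) : ℝ) ≤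
      occurrences w (invRev v) + occurrences w (invRev u) + w.length := by
    rw [invRev_append]
    exact_mod_cast occurrences_append_le_add w _ _
  unfold signedCount
  rw [abs_le]
  constructor <;> linarith

variable {F : Type u} [Group F] (B : FreeGroupBasis ι F)

theorem brooks_eq_signedCount (w x : F) :
    brooks B w x = signedCount (reducedWord B w) (reducedWord B x) := by
  simp [brooks, signedCount, reducedWord, toWord_inv]

theorem brooks_inv (w x : F) : brooks B w x⁻¹ = -brooks B w x := by
  simp [brooks]

/-- With `a = u t` and `b = t⁻¹ v`, the signed counts of `t` and `t⁻¹` cancel. Only the three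
junctions `u|t`, `t⁻¹|v` and `u|v` contribute errors. -/
theorem abs_brooks_le {w : F} (hw : w ≠ 1) (a b : F) :
    |brooks B w a - brooks B w (a * b) + brooks B w b| ≤ 3 * (reducedWord B w).length := by
  have hw' : reducedWord B w ≠ [] := by simpa [reducedWord, toWord_eq_nil_iff] using hw
  obtain ⟨u, t, v, h1, h2, h3⟩ := exists_toWord_mul (B.repr a) (B.repr b)
  rw [← _root_.map_mul] at h3
  have e1 := abs_le.1 (abs_signedCount_append_le hw' u t)
  have e2 := abs_le.1 (abs_signedCount_append_le hw' (invRev t) v)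
  have e3 := abs_le.1 (abs_signedCount_append_le hw' u v)
  rw [signedCount_invRev] at e2
  simp only [brooks_eq_signedCount]
  rw [show reducedWord B a = _ from h1, show reducedWord B b = _ from h2,
    show reducedWord B (a * b) = _ from h3, abs_le]
  constructor <;> linarith

theorem toWord_pow_of_isCyclicallyReduced {x : FreeGroup ι} (hx : IsCyclicallyReduced x.toWord)
    (n : ℕ) : (x ^ n).toWord = (List.replicate n x.toWord).flatten := by
  rw [toWord_pow, (hx.flatten_replicate n).isReduced.reduce_eq]

/-- Otherwise `X = vu` is a rotation of its inverse `uv`, which forces `u = u⁻¹` and `v = v⁻¹`; a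
free group has no involutions. -/
theorem not_infix_invRev_flatten {X : List (ι × Bool)} (hX : IsReduced X) (hne : X ≠ []) (n : ℕ) :
    ¬ X <:+: (List.replicate n (invRev X)).flatten := by
  intro h
  obtain ⟨u, v, h1, h2⟩ := exists_rotation_of_infix_flatten (by simp) n h
  have key : ∀ s : List (ι × Bool), IsReduced s → s = invRev s → s = [] := by
    intro s hs h
    have h3 : (mk s) ^ 2 = 1 := by
      rw [pow_two]
      nth_rw 2 [h]
      rw [← inv_mk, mul_inv_cancel]
    have h4 : mk s = 1 := (pow_eq_one_iff_left two_ne_zero).1 h3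
    rw [← hs.reduce_eq, ← toWord_mk, h4, toWord_one]
  rw [h2, invRev_append] at h1
  obtain ⟨h3, h4⟩ := List.append_inj h1 (by simp)
  subst h2
  have hu := key u (hX.infix ⟨v, [], by simp⟩) h3.symm
  have hv := key v (hX.infix ⟨[], u, by simp⟩) h4.symm
  simp [hu, hv] at hne

theorem invRev_flatten_replicate (X : List (ι × Bool)) (n : ℕ) :
    invRev (List.replicate n X).flatten = (List.replicate n (invRev X)).flatten := by
  induction n with
  | zero => simp
  | succ n ih =>
    rw [List.replicate_succ', List.flatten_concat, invRev_append, ih, List.replicate_succ,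
      List.flatten_cons]

theorem le_brooks_sq_pow {x : F} (hx : IsCyclicallyReduced (reducedWord B x)) (hne : x ≠ 1)
    (n : ℕ) : (n : ℝ) - 1 ≤ brooks B (x ^ 2) (x ^ n) := by
  have hX : reducedWord B x ≠ [] := by simpa [reducedWord, toWord_eq_nil_iff] using hne
  have hpow : ∀ n : ℕ, reducedWord B (x ^ n) = (List.replicate n (reducedWord B x)).flatten := by
    intro n
    rw [reducedWord, map_pow, toWord_pow_of_isCyclicallyReduced hx]
    rfl
  have hsq : reducedWord B (x ^ 2) = reducedWord B x ++ reducedWord B x := by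
    simp [hpow, List.replicate_succ]
  have hinv : ∀ n : ℕ, reducedWord B (x ^ n)⁻¹ =
      (List.replicate n (invRev (reducedWord B x))).flatten := by
    intro n
    rw [← invRev_flatten_replicate, ← hpow]
    simp only [reducedWord, _root_.map_inv, toWord_inv]
  have h0 : occurrences (reducedWord B (x ^ 2)) (reducedWord B (x ^ n)⁻¹) = 0 := by
    rw [occurrences_eq_zero_iff, hsq, hinv]
    intro h
    exact not_infix_invRev_flatten hx.isReduced hX n
      ((List.infix_append [] _ (reducedWord B x)).trans h)
  rw [brooks, h0]
  cases n with
  | zero =>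
    have : (0 : ℝ) ≤ occurrences (reducedWord B (x ^ 2)) (reducedWord B (x ^ 0)) := by positivity
    push_cast
    linarith
  | succ n =>
    have := le_occurrences_replicate_flatten hX n
    rw [← hpow, ← hsq] at this
    have h' : (n : ℝ) ≤ occurrences (reducedWord B (x ^ 2)) (reducedWord B (x ^ (n + 1))) := by
      exact_mod_cast this
    push_cast
    linarith

theorem one_le_homogenization_brooks_sq {x : F} (hx : IsCyclicallyReduced (reducedWord B x))
    (hne : x ≠ 1) {q : F → ℝ} (hq : IsHomogenization (brooks B (x ^ 2)) q) : 1 ≤ q x := by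
  have h1 : Filter.Tendsto (fun n : ℕ => 1 - 1 / (n : ℝ)) Filter.atTop (nhds (1 - 0)) :=
    tendsto_const_nhds.sub (tendsto_const_div_atTop_nhds_zero_nat 1)
  rw [sub_zero] at h1
  refine le_of_tendsto_of_tendsto h1 (hq x) ?_
  filter_upwards [Filter.eventually_gt_atTop 0] with n hn
  have hn' : (0 : ℝ) < n := by exact_mod_cast hn
  rw [le_div_iff₀ hn']
  have := le_brooks_sq_pow B hx hne n
  have h2 : (1 - 1 / (n : ℝ)) * n = n - 1 := by field_simp
  linarith

end Brooks

end AutNorm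

/-! ### Almost invariant sets and letters -/

namespace AutNorm

universe u

/-- A subset of a group is almost invariant if it differs from each of its right translates by a
finite set only. -/
def AlmostInvariant {G : Type u} [Group G] (A : Set G) : Prop :=
  ∀ s : G, {g | ¬ (g ∈ A ↔ g * s ∈ A)}.Finite

theorem almostInvariant_of_closure {G : Type u} [Group G] {A S : Set G}
    (hS : Subgroup.closure S = ⊤) (h : ∀ s ∈ S, {g | ¬ (g ∈ A ↔ g * s ∈ A)}.Finite) :
    AlmostInvariant A := by
  intro s
  have hs : s ∈ Subgroup.closure S := by rw [hS]; trivial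
  induction hs using Subgroup.closure_induction with
  | mem s hs => exact h s hs
  | one => simp
  | mul s t _ _ hs ht =>
    refine (hs.union (ht.preimage (mul_left_injective s).injOn)).subset fun g hg => ?_
    simp only [Set.mem_union, Set.mem_preimage, Set.mem_ofPred_eq, mul_assoc] at *
    tauto
  | inv s _ hs =>
    refine (hs.preimage (mul_left_injective s⁻¹).injOn).subset fun g hg => ?_
    simp only [Set.mem_preimage, Set.mem_ofPred_eq, inv_mul_cancel_right] at *
    tauto

open FreeGroup

/-- The inverse of a letter. -/
def letterInv {ι : Type u} (a : ι × Bool) : ι × Bool := (a.1, !a.2)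

section Letters

variable {ι : Type u}

theorem letterInv_letterInv (a : ι × Bool) : letterInv (letterInv a) = a := by
  simp [letterInv]

theorem letterInv_ne (a : ι × Bool) : letterInv a ≠ a := by
  simp [letterInv, Prod.ext_iff]

theorem invRev_append_singleton (L : List (ι × Bool)) (a : ι × Bool) :
    invRev (L ++ [a]) = letterInv a :: invRev L := by
  simp [invRev, letterInv]

theorem mk_singleton_letterInv (a : ι × Bool) : mk [letterInv a] = (mk [a])⁻¹ := by
  simp [inv_mk, invRev, letterInv]

theorem compatible_iff_ne_letterInv {a b : ι × Bool} :
    (a.1 = b.1 → a.2 = b.2) ↔ b ≠ letterInv a := by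
  obtain ⟨i, x⟩ := a
  obtain ⟨j, y⟩ := b
  cases x <;> cases y <;> simp [letterInv, eq_comm]

theorem isReduced_append_cons_iff {W T : List (ι × Bool)} {z : ι × Bool} :
    FreeGroup.IsReduced (W ++ z :: T) ↔ FreeGroup.IsReduced W ∧ FreeGroup.IsReduced (z :: T) ∧
      W.getLast?.map letterInv ≠ some z := by
  unfold FreeGroup.IsReduced
  rw [List.isChain_append]
  refine and_congr_right fun _ => and_congr_right fun _ => ?_
  rcases List.eq_nil_or_concat W with rfl | ⟨L, a, rfl⟩
  · simp
  · simp only [List.concat_eq_append, List.getLast?_append, List.getLast?_singleton, Option.some_or,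
      Option.mem_def, Option.some.injEq, forall_eq', List.head?_cons, Option.map_some]
    rw [compatible_iff_ne_letterInv, ne_comm, ne_eq, ne_eq, Option.some.injEq]

theorem isReduced_invRev {L : List (ι × Bool)} (h : FreeGroup.IsReduced L) :
    FreeGroup.IsReduced (invRev L) := by
  classical
  rw [isReduced_iff_reduce_eq] at *
  rw [reduce_invRev, h]

end Letters

/-! ### The almost invariant set of a basis element -/

section Factor

variable {κ : Type u}

open Classical in
-- Right multiplication by a generator changes only the end of a word. It affects the first letter
-- only near the identity, and there the condition can change only for `g = 1` and `k = j`.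
theorem head?_toWord_mul_of {j k : κ} {g : FreeGroup κ} (h : k ≠ j ∨ g ≠ 1) :
    g.toWord.head? = some (j, true) ↔ (g * of k).toWord.head? = some (j, true) := by
  obtain ⟨u, t, v, h1, h2, h3⟩ := exists_toWord_mul g (of k)
  rw [h1, h3]
  cases u with
  | cons a u => simp
  | nil =>
    rw [toWord_of] at h2
    rcases List.eq_nil_or_concat t with rfl | ⟨t', a, rfl⟩
    · have hg : g = 1 := by rw [← toWord_eq_nil_iff, h1]; rfl
      have hk : k ≠ j := by tauto
      simp only [invRev_empty, List.nil_append] at h2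
      simp [← h2, hk]
    · rw [List.concat_eq_append, invRev_append_singleton] at *
      simp only [List.cons_append, List.cons.injEq, List.nil_eq, List.append_eq_nil_iff] at h2
      have ht : t' = [] := by
        have := congrArg List.length h2.2.1
        simpa using this
      have ha : a = (k, false) := by
        rw [← letterInv_letterInv a, ← h2.1]; rfl
      simp [ht, ha, h2.2.2]

open Classical in
theorem exists_almostInvariant_of_ne (i j : κ) (hij : i ≠ j) :
    ∃ A : Set (FreeGroup κ), AlmostInvariant A ∧ A.Infinite ∧ Aᶜ.Infinite ∧
      ∀ g, g ∈ A ↔ g * of i ∈ A := by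
  refine ⟨{g | g.toWord.head? = some (j, true)}, ?_, ?_, ?_, ?_⟩
  · refine almostInvariant_of_closure (FreeGroup.closure_range_of κ) ?_
    rintro _ ⟨k, rfl⟩
    refine (Set.finite_singleton (1 : FreeGroup κ)).subset fun g hg => ?_
    by_contra hne
    exact hg (head?_toWord_mul_of (Or.inr hne))
  · refine Set.infinite_of_injective_forall_mem (f := fun n : ℕ => of j ^ (n + 1)) ?_ ?_
    · intro m n h
      have := congrArg FreeGroup.norm h
      simpa [norm_of_pow] using this
    · intro n
      simp [toWord_of_pow, List.replicate_succ]
  · refine Set.infinite_of_injective_forall_mem (f := fun n : ℕ => of i ^ (n + 1)) ?_ ?_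
    · intro m n h
      have := congrArg FreeGroup.norm h
      simpa [norm_of_pow] using this
    · intro n
      simp [toWord_of_pow, List.replicate_succ, hij]
  · intro g
    exact head?_toWord_mul_of (Or.inl hij)

theorem exists_almostInvariant_of_basis {F : Type u} [Group F] (B : FreeGroupBasis κ F) (i j : κ)
    (hij : i ≠ j) : ∃ A : Set F, AlmostInvariant A ∧ A.Infinite ∧ Aᶜ.Infinite ∧
      ∀ g, g ∈ A ↔ g * B i ∈ A := by
  obtain ⟨A, h1, h2, h3, h4⟩ := exists_almostInvariant_of_ne i j hij
  refine ⟨B.repr ⁻¹' A, fun s => ?_, ?_, ?_, fun g => ?_⟩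
  · refine ((h1 (B.repr s)).preimage B.repr.injective.injOn).subset fun g hg => ?_
    simpa using hg
  · exact h2.preimage (by simp [B.repr.surjective.range_eq])
  · rw [← Set.preimage_compl]
    exact h3.preimage (by simp [B.repr.surjective.range_eq])
  · simpa using h4 (B.repr g)

end Factor

/-! ### Cuts of the Whitehead graph -/

section Cut

open Classical

variable {ι : Type u}

/-- The elements of the free group whose reduced word begins with `W`. -/
def cone (W : List (ι × Bool)) : Set (FreeGroup ι) := {g | W <+: g.toWord}

theorem isReduced_of_mem_cone {W : List (ι × Bool)} {g : FreeGroup ι} (hg : g ∈ cone W) :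
    FreeGroup.IsReduced W :=
  isReduced_toWord.infix hg.isInfix

theorem getLast?_ne_of_mem_cone {W : List (ι × Bool)} {z : ι × Bool} {g : FreeGroup ι}
    (hg : g ∈ cone (W ++ [z])) : W.getLast?.map letterInv ≠ some z :=
  (isReduced_append_cons_iff.1 (isReduced_of_mem_cone hg)).2.2

theorem mk_mem_cone {W T : List (ι × Bool)} {z : ι × Bool} (hW : FreeGroup.IsReduced W)
    (hz : W.getLast?.map letterInv ≠ some z) (hT : FreeGroup.IsReduced (z :: T)) :
    mk W * mk (z :: T) ∈ cone (W ++ [z]) := by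
  have h : FreeGroup.IsReduced (W ++ z :: T) := isReduced_append_cons_iff.2 ⟨hW, hT, hz⟩
  change W ++ [z] <+: _
  rw [mul_mk, toWord_mk, h.reduce_eq]
  exact ⟨T, by simp⟩

theorem cone_subset (W : List (ι × Bool)) : cone W ⊆ {mk W} ∪ ⋃ z, cone (W ++ [z]) := by
  rintro g ⟨T, hT⟩
  cases T with
  | nil =>
    left
    rw [Set.mem_singleton_iff, ← mk_toWord (x := g), ← hT, List.append_nil]
  | cons z T =>
    right
    rw [Set.mem_iUnion]
    exact ⟨z, T, by rw [← hT]; simp⟩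

theorem exists_infinite_cone_inter [Finite ι] {W : List (ι × Bool)} {A : Set (FreeGroup ι)}
    (h : (cone W ∩ A).Infinite) : ∃ z, (cone (W ++ [z]) ∩ A).Infinite := by
  by_contra! hcon
  refine h (((Set.finite_singleton (mk W)).union
    (Set.finite_iUnion fun z => hcon z)).subset ?_)
  rintro g ⟨hg, hgA⟩
  rcases cone_subset W hg with hg | hg
  · exact Or.inl hg
  · obtain ⟨z, hz⟩ := Set.mem_iUnion.1 hg
    exact Or.inr (Set.mem_iUnion.2 ⟨z, hz, hgA⟩)

/-- With finitely many generators, only finitely many edges of the Cayley tree join `A` to its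
complement. A cone based beyond all of them lies on one side. -/
theorem AlmostInvariant.exists_pure_of_length_le [Finite ι] {A : Set (FreeGroup ι)}
    (hA : AlmostInvariant A) : ∃ N : ℕ, ∀ W : List (ι × Bool), N ≤ W.length →
      ¬ ((cone W ∩ A).Infinite ∧ (cone W ∩ Aᶜ).Infinite) := by
  obtain ⟨N, hN⟩ := ((Set.finite_iUnion fun s : ι × Bool => hA (mk [s])).image
    FreeGroup.norm).bddAbove
  refine ⟨N + 1, fun W hW hinf => ?_⟩
  have key : ∀ T : List (ι × Bool), FreeGroup.IsReduced (W ++ T) →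
      (mk (W ++ T) ∈ A ↔ mk W ∈ A) := by
    intro T
    induction T using List.reverseRecOn with
    | nil => simp
    | append_singleton T s ih =>
      intro h
      have h' : FreeGroup.IsReduced (W ++ T) := h.infix ⟨[], [s], by simp⟩
      rw [← ih h', ← List.append_assoc, ← mul_mk, iff_comm]
      by_contra hcon
      have h1 : FreeGroup.norm (mk (W ++ T)) ≤ N := hN ⟨_, Set.mem_iUnion.2 ⟨s, hcon⟩, rfl⟩
      rw [FreeGroup.norm, toWord_mk, h'.reduce_eq, List.length_append] at h1
      omega
  have key' : ∀ g ∈ cone W, (g ∈ A ↔ mk W ∈ A) := by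
    rintro g ⟨T, hT⟩
    have h1 := key T (by rw [hT]; exact isReduced_toWord)
    rwa [hT, mk_toWord] at h1
  obtain ⟨g, hg, hgA⟩ := hinf.1.nonempty
  obtain ⟨g', hg', hgA'⟩ := hinf.2.nonempty
  exact hgA' ((key' g' hg').2 ((key' g hg).1 hgA))

/-- A nontrivial almost invariant set that is invariant under right multiplication by a cyclically
reduced element `c` exhibits a cut vertex of the Whitehead graph of `c`, or shows that this graph is
disconnected. -/
theorem AlmostInvariant.exists_cut [Finite ι] {A : Set (FreeGroup ι)} (hA : AlmostInvariant A)
    (hinf : A.Infinite) (hinf' : Aᶜ.Infinite) {c : FreeGroup ι} (hc : ∀ g, g ∈ A ↔ g * c ∈ A)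
    (hcr : IsCyclicallyReduced c.toWord) :
    ∃ (P : Set (ι × Bool)) (d : Option (ι × Bool)), (∃ p ∈ P, d ≠ some p) ∧
      (∃ p ∉ P, d ≠ some p) ∧ ∀ (n : ℕ) (a z : ι × Bool),
        [a, z] <:+: (List.replicate n c.toWord).flatten → d ≠ some (letterInv a) → d ≠ some z →
        (letterInv a ∈ P ↔ z ∈ P) := by
  obtain ⟨N, hN⟩ := hA.exists_pure_of_length_le
  obtain ⟨W, hW, hmax⟩ : ∃ W : List (ι × Bool),
      ((cone W ∩ A).Infinite ∧ (cone W ∩ Aᶜ).Infinite) ∧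
      ∀ z, ¬ ((cone (W ++ [z]) ∩ A).Infinite ∧ (cone (W ++ [z]) ∩ Aᶜ).Infinite) := by
    -- Without a deepest mixed cone, mixed cones of every length would exist.
    by_contra! hcon
    have : ∀ n : ℕ, ∃ W : List (ι × Bool), W.length = n ∧
        ((cone W ∩ A).Infinite ∧ (cone W ∩ Aᶜ).Infinite) := by
      intro n
      induction n with
      | zero =>
        have : cone ([] : List (ι × Bool)) = Set.univ := by ext g; simp [cone]
        exact ⟨[], rfl, by simpa [this], by simpa [this]⟩
      | succ n ih =>
        obtain ⟨W, hWn, hW⟩ := ih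
        obtain ⟨z, hz⟩ := hcon W hW
        exact ⟨W ++ [z], by simp [hWn], hz⟩
    obtain ⟨W, hWn, hW⟩ := this N
    exact hN W hWn.ge hW
  obtain ⟨g₀, hg₀⟩ := hW.1.nonempty
  have hWred := isReduced_of_mem_cone hg₀.1
  -- The exceptional vertex is the direction from `W` back to the root; there is none when `W` is
  -- empty.
  refine ⟨{z | (cone (W ++ [z]) ∩ A).Infinite}, W.getLast?.map letterInv, ?_, ?_, ?_⟩
  · obtain ⟨z, hz⟩ := exists_infinite_cone_inter hW.1
    obtain ⟨g, hg⟩ := hz.nonempty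
    exact ⟨z, hz, getLast?_ne_of_mem_cone hg.1⟩
  · obtain ⟨z, hz⟩ := exists_infinite_cone_inter hW.2
    obtain ⟨g, hg⟩ := hz.nonempty
    exact ⟨z, fun h => hmax z ⟨h, hz⟩, getLast?_ne_of_mem_cone hg.1⟩
  -- The translated axis points `mk W * (mk (S ++ [a]))⁻¹ * c ^ k` all lie on the same side of `A`.
  -- They run into the cone of `z` for large `k` and into that of `a⁻¹` for `k ≤ 0`. Neither cone is
  -- mixed, so both get the side of the axis.
  · rintro n a z ⟨S, T, hST⟩ ha hz
    have hc1 : c ≠ 1 := by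
      rintro rfl
      simp at hST
    have hpow : ∀ k : ℕ, c ^ k = mk (List.replicate k c.toWord).flatten := fun k => by
      rw [← pow_mk, mk_toWord]
    have hred : ∀ k : ℕ, FreeGroup.IsReduced (List.replicate k c.toWord).flatten := fun k =>
      (hcr.flatten_replicate k).isReduced
    have hinjz : Function.Injective fun k : ℤ => mk W * (mk (S ++ [a]))⁻¹ * c ^ k := by
      intro k l h
      exact injective_zpow_iff_not_isOfFinOrder.2 (not_isOfFinOrder_of_isMulTorsionFree hc1)
        (mul_left_cancel h)
    have hinv : ∀ (g : FreeGroup ι) (k : ℕ), g ∈ A ↔ g * c ^ k ∈ A := by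
      intro g k
      induction k with
      | zero => simp
      | succ k ih => rw [ih, hc, pow_succ, mul_assoc]
    have hinvz : ∀ (g : FreeGroup ι) (k : ℤ), g ∈ A ↔ g * c ^ k ∈ A := by
      intro g k
      obtain ⟨k, rfl | rfl⟩ := k.eq_nat_or_neg
      · simpa using hinv g k
      · have := hinv (g * c ^ (-k : ℤ)) k
        rw [this]
        simp
    have hzmem : ∀ k : ℕ, mk W * (mk (S ++ [a]))⁻¹ * c ^ ((n + k : ℕ) : ℤ) ∈ cone (W ++ [z]) := by
      intro k
      have h1 : c ^ (n + k) =
          mk (S ++ [a]) * mk (z :: (T ++ (List.replicate k c.toWord).flatten)) := by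
        rw [pow_add, hpow n, hpow k, ← hST, mul_mk, mul_mk]
        simp
      have h2 : FreeGroup.IsReduced (z :: (T ++ (List.replicate k c.toWord).flatten)) := by
        refine (hred (n + k)).infix ⟨S ++ [a], [], ?_⟩
        rw [List.replicate_add, List.flatten_append, ← hST]
        simp
      rw [zpow_natCast, h1, mul_assoc, inv_mul_cancel_left]
      exact mk_mem_cone hWred hz h2
    have hamem : ∀ k : ℕ, mk W * (mk (S ++ [a]))⁻¹ * c ^ (-(k : ℤ)) ∈
        cone (W ++ [letterInv a]) := by
      intro k
      have h1 : (mk (S ++ [a]))⁻¹ * c ^ (-(k : ℤ)) =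
          mk (letterInv a :: invRev ((List.replicate k c.toWord).flatten ++ S)) := by
        rw [← invRev_append_singleton, ← inv_mk, List.append_assoc, zpow_neg, zpow_natCast, hpow,
          ← mul_inv_rev, mul_mk]
      have h2 : FreeGroup.IsReduced
          (letterInv a :: invRev ((List.replicate k c.toWord).flatten ++ S)) := by
        rw [← invRev_append_singleton]
        refine isReduced_invRev ((hred (k + n)).infix ⟨[], z :: T, ?_⟩)
        rw [List.replicate_add, List.flatten_append, ← hST]
        simp
      rw [mul_assoc, h1]
      exact mk_mem_cone hWred ha h2
    have hinjn : Function.Injective fun k : ℕ =>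
        mk W * (mk (S ++ [a]))⁻¹ * c ^ ((n + k : ℕ) : ℤ) := fun k l h => by
      have := hinjz h
      omega
    have hinja : Function.Injective fun k : ℕ =>
        mk W * (mk (S ++ [a]))⁻¹ * c ^ (-(k : ℤ)) := fun k l h => by
      have := hinjz h
      omega
    by_cases hβ : mk W * (mk (S ++ [a]))⁻¹ ∈ A
    · refine iff_of_true ?_ ?_
      · exact Set.infinite_of_injective_forall_mem hinja
          fun k => ⟨hamem k, (hinvz _ _).1 hβ⟩
      · exact Set.infinite_of_injective_forall_mem hinjn
          fun k => ⟨hzmem k, (hinvz _ _).1 hβ⟩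
    · refine iff_of_false (fun h => hmax _ ⟨h, ?_⟩) (fun h => hmax _ ⟨h, ?_⟩)
      · exact Set.infinite_of_injective_forall_mem hinja
          fun k => ⟨hamem k, fun h => hβ ((hinvz _ _).2 h)⟩
      · exact Set.infinite_of_injective_forall_mem hinjn
          fun k => ⟨hzmem k, fun h => hβ ((hinvz _ _).2 h)⟩

end Cut

end AutNorm

namespace AutNorm

universe u

open Classical FreeGroup

variable {ι : Type u}

/-! ### Whitehead automorphisms -/

section Automorphism

/-- The endomorphism of a free group that multiplies each letter `y` other than `d` and its inverse
by `d ^ χ y` from the left and by the inverse of `d ^ χ y⁻¹` from the right. -/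
noncomputable def whiteheadHom (d : ι × Bool) (χ : ι × Bool → ℤ) : FreeGroup ι →* FreeGroup ι :=
  FreeGroup.lift fun i => if i = d.1 then of i else
    mk [d] ^ χ (i, true) * of i * mk [d] ^ (-χ (i, false))

theorem whiteheadHom_self (d : ι × Bool) (χ : ι × Bool → ℤ) :
    whiteheadHom d χ (mk [d]) = mk [d] := by
  obtain ⟨i, b⟩ := d
  cases b <;> simp [whiteheadHom, of, inv_mk, invRev]

theorem whiteheadHom_comp_neg (d : ι × Bool) (χ : ι × Bool → ℤ) :
    (whiteheadHom d χ).comp (whiteheadHom d (-χ)) = MonoidHom.id _ := by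
  ext i
  by_cases hi : i = d.1
  · simp [whiteheadHom, hi]
  · have h : ∀ χ, whiteheadHom d χ (of i) =
        mk [d] ^ χ (i, true) * of i * mk [d] ^ (-χ (i, false)) := by
      intro χ
      simp [whiteheadHom, hi]
    rw [MonoidHom.comp_apply, h (-χ), _root_.map_mul, _root_.map_mul, map_zpow, map_zpow,
      whiteheadHom_self, h, MonoidHom.id_apply]
    simp only [Pi.neg_apply]
    group

/-- The Whitehead automorphism with multiplier `d`. -/
noncomputable def whiteheadEquiv (d : ι × Bool) (χ : ι × Bool → ℤ) :
    FreeGroup ι ≃* FreeGroup ι :=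
  MonoidHom.toMulEquiv (whiteheadHom d χ) (whiteheadHom d (-χ))
    (by simpa using whiteheadHom_comp_neg d (-χ)) (whiteheadHom_comp_neg d χ)

/-- These values of `χ` bring `d` and `d⁻¹` under the formula for the other letters, with an empty
core in place of the letter. -/
theorem whiteheadHom_mk_singleton (d : ι × Bool) (χ : ι × Bool → ℤ) (hd : χ d = 1)
    (hd' : χ (letterInv d) = 0) (y : ι × Bool) :
    whiteheadHom d χ (mk [y]) =
      mk [d] ^ χ y * (if y = d ∨ letterInv y = d then 1 else mk [y]) *
        mk [d] ^ (-χ (letterInv y)) := by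
  by_cases hy : y = d
  · subst hy
    rw [whiteheadHom_self, hd, hd']
    simp
  by_cases hy' : letterInv y = d
  · have h : y = letterInv d := by rw [← hy', letterInv_letterInv]
    rw [hy', hd, h, hd', mk_singleton_letterInv, _root_.map_inv, whiteheadHom_self]
    simp
  · rw [if_neg (by tauto)]
    obtain ⟨i, b⟩ := y
    have hi : i ≠ d.1 := by
      rintro rfl
      obtain ⟨i, b'⟩ := d
      cases b <;> cases b' <;> simp_all [letterInv]
    have h : whiteheadHom d χ (of i) =
        mk [d] ^ χ (i, true) * of i * mk [d] ^ (-χ (i, false)) := by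
      simp [whiteheadHom, hi]
    cases b with
    | true => exact h
    | false =>
      have h1 : mk [(i, false)] = (of i)⁻¹ := by simp [of, inv_mk, invRev]
      rw [h1, _root_.map_inv, h]
      simp only [letterInv, Bool.not_false]
      group

end Automorphism

/-! ### The effect of a Whitehead automorphism on length -/

section Length

variable {d : ι × Bool} {Q : Set (ι × Bool)}

/-- The indicator function of a set of letters. -/
noncomputable def letterIndicator (Q : Set (ι × Bool)) (y : ι × Bool) : ℤ := if y ∈ Q then 1 else 0

theorem norm_mk_zpow_sub_le (d y z : ι × Bool) (Q : Set (ι × Bool)) :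
    (mk [d] ^ (letterIndicator Q z - letterIndicator Q y)).norm ≤
      if y ∈ Q ↔ z ∈ Q then 0 else 1 := by
  have h : (mk [d]).norm ≤ 1 := norm_mk_le
  by_cases hy : y ∈ Q <;> by_cases hz : z ∈ Q <;> simp [letterIndicator, hy, hz, -inv_mk, h]

/-- The accounting at a pair `a`, `z`: `p₁`, `p₂`, `p₃` stand for `a⁻¹ = d`, `z = d`, `z⁻¹ = d`, and
`p₄` says that `Q` does not separate `a⁻¹` from `z`. A separated pair costs one power of `d`, paid
by the core lost at `z = d` or by the credit carried over from `a = d⁻¹`. A pair at `d` that is not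
separated leaves its payment unspent. -/
theorem charge_le {p₁ p₂ p₃ p₄ : Prop} [Decidable p₁] [Decidable p₂] [Decidable p₃]
    [Decidable p₄] {k m n : ℕ} (hm : m ≤ if p₄ then 0 else 1)
    (hn : n ≤ if p₂ ∨ p₃ then 0 else 1) (hk : k ≤ m + n) (h₃ : p₂ → ¬ p₃) (h₁ : p₂ → ¬ p₁)
    (h : p₄ ∨ p₁ ∨ p₂) :
    k + (if p₃ then 1 else 0) + (if (p₁ ∨ p₂) ∧ p₄ then 1 else 0) ≤ 1 + if p₁ then 1 else 0 := by
  by_cases p₁ <;> by_cases p₂ <;> by_cases p₃ <;> by_cases p₄ <;> simp_all <;> omega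

theorem norm_whitehead_letter_le (hd : d ∈ Q) (hd' : letterInv d ∉ Q) {a z : ι × Bool}
    (haz : z ≠ letterInv a)
    (hcut : (letterInv a ∈ Q ↔ z ∈ Q) ∨ letterInv a = d ∨ z = d) :
    (mk [d] ^ (-letterIndicator Q (letterInv a)) * whiteheadHom d (letterIndicator Q) (mk [z]) *
      mk [d] ^ letterIndicator Q (letterInv z)).norm + (if letterInv z = d then 1 else 0) +
      (if (letterInv a = d ∨ z = d) ∧ (letterInv a ∈ Q ↔ z ∈ Q) then 1 else 0) ≤
      1 + if letterInv a = d then 1 else 0 := by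
  rw [whiteheadHom_mk_singleton d _ (by simp [letterIndicator, hd])
    (by simp [letterIndicator, hd'])]
  set θ : FreeGroup ι := if z = d ∨ letterInv z = d then 1 else mk [z] with hθ
  have hθn : θ.norm ≤ if z = d ∨ letterInv z = d then 0 else 1 := by
    rw [hθ]
    split_ifs
    · simp
    · exact norm_mk_le
  have e : mk [d] ^ (-letterIndicator Q (letterInv a)) * (mk [d] ^ letterIndicator Q z * θ *
      mk [d] ^ (-letterIndicator Q (letterInv z))) * mk [d] ^ letterIndicator Q (letterInv z) =
      mk [d] ^ (letterIndicator Q z - letterIndicator Q (letterInv a)) * θ := by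
    group
  rw [e]
  have h1 := norm_mul_le (mk [d] ^ (letterIndicator Q z - letterIndicator Q (letterInv a))) θ
  have h2 := norm_mk_zpow_sub_le d (letterInv a) z Q
  have h3 : z = d → letterInv z ≠ d := by
    rintro rfl
    exact letterInv_ne z
  have h4 : z = d → letterInv a ≠ d := by
    rintro rfl h
    exact haz h.symm
  exact charge_le h2 hθn h1 h3 h4 hcut

/-- Regrouping the powers of `d` between consecutive letters lets the local estimates telescope; the
credit at each letter passes to the next. One unseparated pair at `d` saves one letter overall. -/
theorem norm_whitehead_le (hd : d ∈ Q) (hd' : letterInv d ∉ Q) (l : List (ι × Bool))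
    (a : ι × Bool)
    (hl : ∀ b z, [b, z] <:+: a :: l → z ≠ letterInv b ∧
      ((letterInv b ∈ Q ↔ z ∈ Q) ∨ letterInv b = d ∨ z = d)) :
    (mk [d] ^ (-letterIndicator Q (letterInv a)) * whiteheadHom d (letterIndicator Q) (mk l) *
      mk [d] ^ letterIndicator Q (letterInv ((a :: l).getLast (by simp)))).norm +
      (if letterInv ((a :: l).getLast (by simp)) = d then 1 else 0) +
      (if ∃ b z, [b, z] <:+: a :: l ∧ (letterInv b = d ∨ z = d) ∧ (letterInv b ∈ Q ↔ z ∈ Q)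
        then 1 else 0) ≤
      l.length + if letterInv a = d then 1 else 0 := by
  induction l generalizing a with
  | nil =>
    have hno : ¬ ∃ b z, [b, z] <:+: [a] ∧ (letterInv b = d ∨ z = d) ∧
        (letterInv b ∈ Q ↔ z ∈ Q) := by
      rintro ⟨b, z, h, -⟩
      simpa using h.length_le
    have e : mk [d] ^ (-letterIndicator Q (letterInv a)) *
        whiteheadHom d (letterIndicator Q) (mk []) * mk [d] ^ letterIndicator Q (letterInv a) =
        1 := by
      rw [← one_eq_mk, _root_.map_one]
      group
    rw [if_neg hno]
    simp only [List.getLast_singleton, e, FreeGroup.norm_one, List.length_nil]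
    by_cases h : letterInv a = d <;> simp [h]
  | cons z l ih =>
    have h1 := ih z fun b y h => hl b y (h.trans (List.suffix_cons a _).isInfix)
    have haz := hl a z ⟨[], l, rfl⟩
    have h2 := norm_whitehead_letter_le hd hd' haz.1 haz.2
    have hbad : (if ∃ b y, [b, y] <:+: a :: z :: l ∧ (letterInv b = d ∨ y = d) ∧
        (letterInv b ∈ Q ↔ y ∈ Q) then 1 else 0) ≤
        (if (letterInv a = d ∨ z = d) ∧ (letterInv a ∈ Q ↔ z ∈ Q) then 1 else 0) +
        (if ∃ b y, [b, y] <:+: z :: l ∧ (letterInv b = d ∨ y = d) ∧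
          (letterInv b ∈ Q ↔ y ∈ Q) then 1 else 0) := by
      by_cases h : ∃ b y, [b, y] <:+: a :: z :: l ∧ (letterInv b = d ∨ y = d) ∧
        (letterInv b ∈ Q ↔ y ∈ Q)
      · rw [if_pos h]
        obtain ⟨b, y, hby, hb⟩ := h
        rcases List.infix_cons_iff.1 hby with hpre | hinf
        · rw [List.cons_prefix_cons, List.cons_prefix_cons] at hpre
          obtain ⟨rfl, rfl, -⟩ := hpre
          rw [if_pos hb]
          omega
        · rw [if_pos (⟨b, y, hinf, hb⟩ : ∃ b y, [b, y] <:+: z :: l ∧ (letterInv b = d ∨ y = d) ∧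
            (letterInv b ∈ Q ↔ y ∈ Q))]
          omega
      · rw [if_neg h]
        omega
    rw [List.getLast_cons_cons]
    set t := (z :: l).getLast (by simp) with ht
    have e : mk [d] ^ (-letterIndicator Q (letterInv a)) *
        whiteheadHom d (letterIndicator Q) (mk (z :: l)) *
        mk [d] ^ letterIndicator Q (letterInv t) =
        (mk [d] ^ (-letterIndicator Q (letterInv a)) *
          whiteheadHom d (letterIndicator Q) (mk [z]) *
          mk [d] ^ letterIndicator Q (letterInv z)) *
        (mk [d] ^ (-letterIndicator Q (letterInv z)) *
          whiteheadHom d (letterIndicator Q) (mk l) *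
          mk [d] ^ letterIndicator Q (letterInv t)) := by
      rw [show z :: l = [z] ++ l from rfl, ← mul_mk, _root_.map_mul]
      group
    rw [e]
    have h3 := norm_mul_le (mk [d] ^ (-letterIndicator Q (letterInv a)) *
          whiteheadHom d (letterIndicator Q) (mk [z]) *
          mk [d] ^ letterIndicator Q (letterInv z))
        (mk [d] ^ (-letterIndicator Q (letterInv z)) *
          whiteheadHom d (letterIndicator Q) (mk l) *
          mk [d] ^ letterIndicator Q (letterInv t))
    simp only [List.length_cons]
    omega

end Length

/-! ### Words of minimal length have no cut -/

section Minimal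

/-- `a` and `z` are cyclically consecutive letters of the word `X`. -/
def CyclicPair (X : List (ι × Bool)) (a z : ι × Bool) : Prop :=
  ∃ l ∈ X.getLast?, [a, z] <:+: l :: X

theorem cons_infix_append_self {X : List (ι × Bool)} {l : ι × Bool} (hl : l ∈ X.getLast?) :
    l :: X <:+: X ++ X := by
  obtain ⟨Y, rfl⟩ := List.mem_getLast?_eq_getLast hl |> fun ⟨h, e⟩ =>
    (⟨X.dropLast, by rw [e, List.dropLast_append_getLast]⟩ : ∃ Y, X = Y ++ [l])
  exact ⟨Y, [], by simp⟩

/-- The pair that wraps around the end of `X` is visible only in the square, which is why `x ^ 2` is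
counted. -/
theorem CyclicPair.infix_append_self {X : List (ι × Bool)} {a z : ι × Bool}
    (h : CyclicPair X a z) : [a, z] <:+: X ++ X := by
  obtain ⟨l, hl, h⟩ := h
  exact h.trans (cons_infix_append_self hl)

theorem CyclicPair.ne_letterInv {X : List (ι × Bool)} (hX : IsCyclicallyReduced X)
    {a z : ι × Bool} (h : CyclicPair X a z) : z ≠ letterInv a := by
  have h1 : FreeGroup.IsReduced (X ++ X) := by
    simpa [List.replicate_succ] using (hX.flatten_replicate 2).isReduced
  have h2 := h1.infix h.infix_append_self
  rw [isReduced_cons_cons] at h2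
  exact compatible_iff_ne_letterInv.1 h2.1

theorem exists_cyclicPair_left {X : List (ι × Bool)} {z : ι × Bool} (hz : z ∈ X) :
    ∃ a, CyclicPair X a z := by
  obtain ⟨s, t, rfl⟩ := List.append_of_mem hz
  obtain ⟨l, hl⟩ : ∃ l, l ∈ (s ++ z :: t).getLast? := by
    rw [List.getLast?_eq_getLast_of_ne_nil (by simp)]
    exact ⟨_, rfl⟩
  rcases List.eq_nil_or_concat s with rfl | ⟨s', a, rfl⟩
  · exact ⟨l, l, hl, [], t, by simp⟩
  · exact ⟨a, l, hl, l :: s', t, by simp⟩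

theorem exists_cyclicPair_right {X : List (ι × Bool)} {a : ι × Bool} (ha : a ∈ X) :
    ∃ z, CyclicPair X a z := by
  obtain ⟨s, t, rfl⟩ := List.append_of_mem ha
  cases t with
  | nil =>
    cases s with
    | nil => exact ⟨a, a, by simp, [], [], by simp⟩
    | cons b s => exact ⟨b, a, by rw [List.getLast?_append]; simp, [], s ++ [a], by simp⟩
  | cons z t =>
    obtain ⟨l, hl⟩ : ∃ l, l ∈ (s ++ a :: z :: t).getLast? := by
      rw [List.getLast?_eq_getLast_of_ne_nil (by simp)]
      exact ⟨_, rfl⟩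
    exact ⟨z, l, hl, l :: s, t, by simp⟩

theorem mem_iff_of_forall_infix {P : Set (ι × Bool)} (l : List (ι × Bool)) (a : ι × Bool)
    (h : ∀ b z, [b, z] <:+: a :: l → (b ∈ P ↔ z ∈ P)) : ∀ y ∈ l, (y ∈ P ↔ a ∈ P) := by
  induction l generalizing a with
  | nil => simp
  | cons z l ih =>
    have h1 := h a z ⟨[], l, rfl⟩
    have h2 := ih z fun b y hby => h b y (hby.trans (List.suffix_cons a _).isInfix)
    intro y hy
    rcases List.mem_cons.1 hy with rfl | hy
    · exact h1.symm
    · rw [h2 y hy, h1]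

variable {x : FreeGroup ι}

/-- Such a pair would be a saving with nothing to offset it, so a conjugate of the Whitehead image
of `x` would be shorter than `x`. -/
theorem not_reducing_cut_of_minimal (hX : IsCyclicallyReduced x.toWord)
    (hmin : ∀ e : FreeGroup ι ≃* FreeGroup ι, x.norm ≤ (e x).norm) {d : ι × Bool}
    {Q : Set (ι × Bool)} (hd : d ∈ Q) (hd' : letterInv d ∉ Q)
    (hcut : ∀ a z, CyclicPair x.toWord a z →
      (letterInv a ∈ Q ↔ z ∈ Q) ∨ letterInv a = d ∨ z = d) {a z : ι × Bool}
    (h : CyclicPair x.toWord a z) (had : letterInv a = d ∨ z = d) :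
    ¬ (letterInv a ∈ Q ↔ z ∈ Q) := by
  intro hbad
  obtain ⟨l, hl, haz⟩ := h
  -- Starting from the last letter `l` closes the word cyclically: the initial and final credits
  -- coincide and cancel.
  have h1 := norm_whitehead_le hd hd' x.toWord l fun b y hby =>
    ⟨CyclicPair.ne_letterInv hX ⟨l, hl, hby⟩, hcut b y ⟨l, hl, hby⟩⟩
  have hne : x.toWord ≠ [] := by
    rintro h
    simp [h] at hl
  have hlast : (l :: x.toWord).getLast (by simp) = l := by
    rw [List.getLast_cons hne]
    rw [List.getLast?_eq_getLast_of_ne_nil hne] at hl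
    simpa using hl
  have hex : ∃ b y, [b, y] <:+: l :: x.toWord ∧ (letterInv b = d ∨ y = d) ∧
      (letterInv b ∈ Q ↔ y ∈ Q) := ⟨a, z, haz, had, hbad⟩
  rw [if_pos hex, hlast, mk_toWord] at h1
  have h2 := hmin ((whiteheadEquiv d (letterIndicator Q)).trans
    (MulAut.conj (mk [d] ^ (-letterIndicator Q (letterInv l)))))
  have e : ((whiteheadEquiv d (letterIndicator Q)).trans
      (MulAut.conj (mk [d] ^ (-letterIndicator Q (letterInv l))))) x =
      mk [d] ^ (-letterIndicator Q (letterInv l)) * whiteheadHom d (letterIndicator Q) x *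
        mk [d] ^ letterIndicator Q (letterInv l) := by
    rw [MulEquiv.trans_apply, MulAut.conj_apply, zpow_neg, inv_inv]
    rfl
  rw [e] at h2
  have h3 : x.norm = x.toWord.length := rfl
  omega

theorem false_of_minimal_of_disconnected (hX : IsCyclicallyReduced x.toWord)
    (hmin : ∀ e : FreeGroup ι ≃* FreeGroup ι, x.norm ≤ (e x).norm)
    (hall : ∀ i : ι, ∃ b, (i, b) ∈ x.toWord) {P : Set (ι × Bool)} (hP : ∃ p, p ∈ P)
    (hP' : ∃ p, p ∉ P)
    (hcut : ∀ a z, CyclicPair x.toWord a z → (letterInv a ∈ P ↔ z ∈ P)) : False := by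
  have hocc : ∀ a : ι × Bool, a ∈ x.toWord ∨ letterInv a ∈ x.toWord := by
    rintro ⟨i, b⟩
    obtain ⟨b', hb'⟩ := hall i
    cases b <;> cases b' <;> simp [letterInv, hb']
  -- If `a ∈ P` but `a⁻¹ ∉ P`, the multiplier `a` with `Q = P` separates no pair, so any pair at `a`
  -- gives a reduction. Once `P` is closed under inverses, all letters of `x` lie on one side.
  have hsymm : ∀ a ∈ P, letterInv a ∈ P := by
    intro a ha
    by_contra ha'
    have key := fun b z h => not_reducing_cut_of_minimal hX hmin ha ha'
      (fun a z h => Or.inl (hcut a z h)) (a := b) (z := z) h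
    rcases hocc a with h | h
    · obtain ⟨b, hb⟩ := exists_cyclicPair_left h
      exact key _ _ hb (Or.inr rfl) (hcut _ _ hb)
    · obtain ⟨z, hz⟩ := exists_cyclicPair_right h
      exact key _ _ hz (Or.inl (letterInv_letterInv a)) (hcut _ _ hz)
  have hsymm' : ∀ a, letterInv a ∈ P ↔ a ∈ P := fun a =>
    ⟨fun h => by simpa [letterInv_letterInv] using hsymm _ h, hsymm a⟩
  obtain ⟨p, hp⟩ := hP
  obtain ⟨p', hp'⟩ := hP'
  have hmem : ∀ a, ∃ y ∈ x.toWord, (y ∈ P ↔ a ∈ P) := by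
    intro a
    rcases hocc a with h | h
    exacts [⟨a, h, Iff.rfl⟩, ⟨_, h, hsymm' a⟩]
  obtain ⟨y, hy, hyp⟩ := hmem p
  obtain ⟨y', hy', hyp'⟩ := hmem p'
  have hne : x.toWord ≠ [] := List.ne_nil_of_mem hy
  have key := mem_iff_of_forall_infix (P := P) x.toWord (x.toWord.getLast hne) fun b z h => by
    rw [← hsymm' b]
    exact hcut b z ⟨_, by rw [List.getLast?_eq_getLast_of_ne_nil hne]; rfl, h⟩
  have h1 := key y hy
  have h2 := key y' hy'
  tauto

/-- Minimality forces every edge at `v` to leave `insert v P`. Hence no edge joins `v` to `P \ {v}`,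
and the graph is already disconnected. -/
theorem false_of_minimal_of_cut_vertex (hX : IsCyclicallyReduced x.toWord)
    (hmin : ∀ e : FreeGroup ι ≃* FreeGroup ι, x.norm ≤ (e x).norm)
    (hall : ∀ i : ι, ∃ b, (i, b) ∈ x.toWord) {P : Set (ι × Bool)} {v : ι × Bool}
    (hP : ∃ p ∈ P, p ≠ v) (hv : letterInv v ∉ P)
    (hcut : ∀ a z, CyclicPair x.toWord a z → letterInv a ≠ v → z ≠ v →
      (letterInv a ∈ P ↔ z ∈ P)) : False := by
  have key := fun a z h => not_reducing_cut_of_minimal hX hmin (d := v) (Q := insert v P)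
    (Set.mem_insert v P) (by
      rw [Set.mem_insert_iff]
      exact not_or.2 ⟨letterInv_ne v, hv⟩)
    (fun a z h => by
      by_cases h1 : letterInv a = v
      · exact Or.inr (Or.inl h1)
      by_cases h2 : z = v
      · exact Or.inr (Or.inr h2)
      · left
        rw [Set.mem_insert_iff, Set.mem_insert_iff]
        have := hcut a z h h1 h2
        tauto) (a := a) (z := z) h
  obtain ⟨p, hp, hpv⟩ := hP
  refine false_of_minimal_of_disconnected hX hmin hall (P := P \ {v}) ⟨p, hp, hpv⟩
    ⟨v, fun h => h.2 rfl⟩ fun a z h => ?_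
  have h1 := key a z h
  have h2 := hcut a z h
  simp only [Set.mem_insert_iff, Set.mem_sdiff, Set.mem_singleton_iff] at *
  tauto

theorem false_of_minimal_of_cut (hX : IsCyclicallyReduced x.toWord)
    (hmin : ∀ e : FreeGroup ι ≃* FreeGroup ι, x.norm ≤ (e x).norm)
    (hall : ∀ i : ι, ∃ b, (i, b) ∈ x.toWord) {P : Set (ι × Bool)} {d : Option (ι × Bool)}
    (hP : ∃ p ∈ P, d ≠ some p) (hP' : ∃ p ∉ P, d ≠ some p)
    (hcut : ∀ a z, CyclicPair x.toWord a z → d ≠ some (letterInv a) → d ≠ some z →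
      (letterInv a ∈ P ↔ z ∈ P)) : False := by
  obtain ⟨p, hp, hpd⟩ := hP
  obtain ⟨p', hp', hpd'⟩ := hP'
  cases d with
  | none =>
    exact false_of_minimal_of_disconnected hX hmin hall ⟨p, hp⟩ ⟨p', hp'⟩
      fun a z h => hcut a z h (by simp) (by simp)
  | some v =>
    have hne : ∀ {y}, some v ≠ some y ↔ y ≠ v := fun {y} => by
      rw [ne_eq, Option.some.injEq, eq_comm]
    simp only [hne] at hcut hpd hpd'
    -- The two sides of the cut are interchangeable; the side without `v⁻¹` is the one that defines
    -- an automorphism with multiplier `v`.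
    by_cases hv : letterInv v ∈ P
    · exact false_of_minimal_of_cut_vertex hX hmin hall (P := Pᶜ) ⟨p', hp', hpd'⟩
        (fun h => h hv) fun a z h h1 h2 => not_congr (hcut a z h h1 h2)
    · exact false_of_minimal_of_cut_vertex hX hmin hall ⟨p, hp, hpd⟩ hv hcut

end Minimal

end AutNorm

namespace AutNorm

universe u

open Classical FreeGroup

/-! ### Primitive elements against minimal words -/

section MinimalBasis

variable {ι : Type u} {x : FreeGroup ι}

/-- Conjugation is an automorphism, and stripping a nonempty conjugator would shorten the word. -/
theorem isCyclicallyReduced_of_minimal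
    (hmin : ∀ e : FreeGroup ι ≃* FreeGroup ι, x.norm ≤ (e x).norm) :
    IsCyclicallyReduced x.toWord := by
  have h := reduceCyclically.conj_conjugator_reduceCyclically x.toWord
  have h1 := hmin (MulAut.conj (mk (reduceCyclically.conjugator x.toWord))⁻¹)
  have e : MulAut.conj (mk (reduceCyclically.conjugator x.toWord))⁻¹ x =
      mk (reduceCyclically x.toWord) := by
    rw [MulAut.conj_apply]
    nth_rw 2 [← mk_toWord (x := x)]
    nth_rw 2 [← h]
    rw [← mul_mk, ← mul_mk, ← inv_mk]
    group
  rw [e] at h1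
  have h2 := h1.trans norm_mk_le
  have h3 := congrArg List.length h
  simp only [List.length_append, invRev_length] at h3
  have h4 : x.norm = x.toWord.length := rfl
  have h5 : reduceCyclically.conjugator x.toWord = [] := List.length_eq_zero_iff.1 (by omega)
  rw [h5] at h
  simp only [List.nil_append, invRev_empty, List.append_nil] at h
  rw [← h]
  exact reduceCyclically.isCyclicallyReduced isReduced_toWord

theorem mk_mem_closure {s : Set ι} (L : List (ι × Bool)) (hL : ∀ y ∈ L, y.1 ∈ s) :
    mk L ∈ Subgroup.closure (of '' s) := by
  induction L with
  | nil => exact Subgroup.one_mem _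
  | cons y L ih =>
    rw [show y :: L = [y] ++ L from rfl, ← mul_mk]
    refine Subgroup.mul_mem _ ?_ (ih fun z hz => hL z (by simp [hz]))
    have h : of y.1 ∈ Subgroup.closure (of '' s) :=
      Subgroup.subset_closure ⟨y.1, hL y (by simp), rfl⟩
    obtain ⟨i, b⟩ := y
    cases b with
    | true => exact h
    | false => simpa [of, inv_mk, invRev] using Subgroup.inv_mem _ h

theorem not_sq_infix_of_isPrimitive [Finite ι] [Nontrivial ι] (hX : IsCyclicallyReduced x.toWord)
    (hmin : ∀ e : FreeGroup ι ≃* FreeGroup ι, x.norm ≤ (e x).norm)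
    (hall : ∀ i : ι, ∃ b, (i, b) ∈ x.toWord) {c : FreeGroup ι} (hc : IsPrimitive c)
    (hcr : IsCyclicallyReduced c.toWord) (n : ℕ) :
    ¬ x.toWord ++ x.toWord <:+: (List.replicate n c.toWord).flatten := by
  intro hinf
  obtain ⟨κ, B, i, rfl⟩ := hc
  have : Nontrivial κ := (Equiv.ofFreeGroupEquiv B.repr).symm.nontrivial
  obtain ⟨j, hj⟩ := exists_ne i
  obtain ⟨A, hA, h1, h2, h3⟩ := exists_almostInvariant_of_basis B i j hj.symm
  obtain ⟨P, d, hP, hP', hcut⟩ := hA.exists_cut h1 h2 h3 hcr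
  exact false_of_minimal_of_cut hX hmin hall hP hP' fun a z h =>
    hcut n a z (h.infix_append_self.trans hinf)

end MinimalBasis

/-! ### The quasimorphism of a nonseparable element -/

section Main

variable {F : Type u} [Group F]

theorem exists_minimal_basis [IsFreeGroup F] (x : F) :
    ∃ B : FreeGroupBasis (IsFreeGroup.Generators F) F,
      ∀ e : FreeGroup (IsFreeGroup.Generators F) ≃* FreeGroup (IsFreeGroup.Generators F),
        (B.repr x).norm ≤ (e (B.repr x)).norm := by
  obtain ⟨B, -, hB⟩ := WellFounded.has_min
    (measure fun B : FreeGroupBasis (IsFreeGroup.Generators F) F => (B.repr x).norm).wf Set.univ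
    ⟨IsFreeGroup.basis F, trivial⟩
  exact ⟨B, fun e => not_lt.1 (hB (FreeGroupBasis.ofRepr (B.repr.trans e)) trivial)⟩

theorem exists_mem_reducedWord_of_not_isSeparable {ι : Type u} (B : FreeGroupBasis ι F) {x : F}
    (hx : ¬ IsSeparable x) (i : ι) : ∃ b, (i, b) ∈ (B.repr x).toWord := by
  by_contra! hcon
  refine hx (isSeparable_of_mem_closure B i ?_)
  have h := mk_mem_closure (s := {i}ᶜ) (B.repr x).toWord fun y hy hyi => by
    obtain ⟨j, b⟩ := y
    obtain rfl : j = i := hyi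
    exact hcon b hy
  rw [mk_toWord] at h
  have h1 := Subgroup.mem_map_of_mem B.repr.symm.toMonoidHom h
  rw [MonoidHom.map_closure, Set.image_image] at h1
  change B.repr.symm (B.repr x) ∈ Subgroup.closure (B '' {i}ᶜ) at h1
  rwa [MulEquiv.symm_apply_apply] at h1

/-- By conjugation invariance `p` may be taken cyclically reduced. The positive count then vanishes
on all its powers, and the other count enters with a minus sign. -/
theorem homogenization_nonpos_of_isPrimitive {ι : Type u} [Finite ι] [Nontrivial ι]
    (B : FreeGroupBasis ι F) {x : F} {q : F → ℝ}
    (hmin : ∀ e : FreeGroup ι ≃* FreeGroup ι, (B.repr x).norm ≤ (e (B.repr x)).norm)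
    (hall : ∀ i : ι, ∃ b, (i, b) ∈ (B.repr x).toWord)
    (hq : IsHomogenization (brooks B (x ^ 2)) q) (hq' : IsHomogeneousQuasimorphism q) {p : F}
    (hp : IsPrimitive p) : q p ≤ 0 := by
  have hX := isCyclicallyReduced_of_minimal hmin
  set L := (B.repr p).toWord with hL
  have hconj := reduceCyclically.conj_conjugator_reduceCyclically L
  set g := B.repr.symm (mk (reduceCyclically.conjugator L)) with hg
  set c := g⁻¹ * p * g with hc
  have hqc : q p = q c := by
    rw [← hq'.map_conj g c, hc]
    congr 1
    group
  have hcp : IsPrimitive c := by simpa [hc] using hp.conj g⁻¹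
  have hcw : (B.repr c).toWord = reduceCyclically L := by
    have hr : IsCyclicallyReduced (reduceCyclically L) :=
      reduceCyclically.isCyclicallyReduced isReduced_toWord
    rw [← hr.isReduced.reduce_eq, ← toWord_mk]
    congr 1
    have hp' : B.repr p = mk (reduceCyclically.conjugator L) * mk (reduceCyclically L) *
        (mk (reduceCyclically.conjugator L))⁻¹ := by
      rw [inv_mk, mul_mk, mul_mk, hconj, hL, mk_toWord]
    rw [hc, _root_.map_mul, _root_.map_mul, _root_.map_inv, hp', hg, MulEquiv.apply_symm_apply]
    group
  have hcr : IsCyclicallyReduced (B.repr c).toWord := by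
    rw [hcw]
    exact reduceCyclically.isCyclicallyReduced isReduced_toWord
  have hcp' : IsPrimitive (B.repr c) := by
    obtain ⟨κ, B', i, h⟩ := hcp
    exact ⟨κ, B'.map B.repr, i, by simp [h]⟩
  rw [hqc]
  refine le_of_tendsto (hq c) (Filter.Eventually.of_forall fun n => ?_)
  have h0 : occurrences (reducedWord B (x ^ 2)) (reducedWord B (c ^ n)) = 0 := by
    rw [occurrences_eq_zero_iff, reducedWord, reducedWord, map_pow, map_pow,
      toWord_pow_of_isCyclicallyReduced hcr, toWord_pow_of_isCyclicallyReduced hX]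
    simpa [List.replicate_succ] using not_sq_infix_of_isPrimitive hX hmin hall hcp' hcr n
  rw [brooks, h0]
  refine div_nonpos_of_nonpos_of_nonneg ?_ (Nat.cast_nonneg n)
  simp

theorem abs_map_primitive_le_of_subsingleton {ι : Type u} [Subsingleton ι] (B : FreeGroupBasis ι F)
    (i : ι) {q : F → ℝ} (hq : IsHomogeneousQuasimorphism q) {p : F} (hp : IsPrimitive p) :
    |q p| ≤ |q (B i)| := by
  have hmem : p ∈ Subgroup.zpowers (B i) := by
    have h1 : Set.range B = {B i} := by
      ext y
      constructor
      · rintro ⟨j, rfl⟩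
        rw [Subsingleton.elim j i]
        rfl
      · rintro rfl
        exact ⟨i, rfl⟩
    rw [Subgroup.zpowers_eq_closure, ← h1, closure_range_basis]
    trivial
  obtain ⟨m, hm⟩ := hmem
  obtain ⟨κ, B', k, rfl⟩ := hp
  have hm' : B i ^ m = B' k := hm
  -- This homomorphism takes the primitive element `B i ^ m` to a generator of `ℤ`, so `m` is a
  -- unit.
  let f : F →* Multiplicative ℤ := B'.lift fun _ => Multiplicative.ofAdd 1
  have h1 : f (B' k) = Multiplicative.ofAdd 1 := by simp [f]
  rw [← hm', map_zpow] at h1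
  have h2 : m * Multiplicative.toAdd (f (B i)) = 1 := by
    have := congrArg Multiplicative.toAdd h1
    simpa using this
  rw [← hm', hq.2, abs_mul]
  rcases Int.isUnit_iff.1 (IsUnit.of_mul_eq_one _ h2) with rfl | rfl <;> simp

theorem isUndistorted_primitiveNorm_of_quasimorphism [IsFreeGroup F] {q : F → ℝ}
    (hq : IsHomogeneousQuasimorphism q) {C : ℝ} (hC : ∀ p : F, IsPrimitive p → |q p| ≤ C) {x : F}
    (hx : q x ≠ 0) : IsUndistorted primitiveNorm x := by
  obtain ⟨K, hK, h⟩ := hq.abs_map_list_prod_le (S := {p : F | IsPrimitive p}) hC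
  have hpos : 0 < |q x| := abs_pos.2 hx
  -- The factor 2 turns the estimate `n * |q x| ≤ K * norm` into a strict one.
  refine ⟨|q x| / (2 * K), by positivity, fun n hn => ?_⟩
  obtain ⟨l, hl, hprod, hlen⟩ :=
    exists_list_length_eq_wordNorm exists_list_isPrimitive_prod_eq (x ^ n)
  have h1 := h l hl
  rw [hprod, hlen, ← zpow_natCast, hq.2, abs_mul] at h1
  simp only [Int.cast_natCast, Nat.abs_cast, zpow_natCast] at h1
  have hn' : (0 : ℝ) < n := by exact_mod_cast hn
  have h2 : 0 < (n : ℝ) * |q x| := by positivity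
  rw [div_mul_eq_mul_div, div_lt_iff₀ (by positivity)]
  unfold primitiveNorm
  nlinarith

theorem exists_brooks_quasimorphism_of_not_isSeparable [IsFreeGroup F] [Nontrivial F] {x : F}
    (hx : ¬ IsSeparable x) :
    ∃ (ι : Type u) (B : FreeGroupBasis ι F) (q : F → ℝ),
      IsCyclicallyReduced (reducedWord B x) ∧ IsHomogenization (brooks B (x ^ 2)) q ∧
      IsHomogeneousQuasimorphism q ∧ (∃ C : ℝ, ∀ p : F, IsPrimitive p → |q p| ≤ C) ∧
      q x ≠ 0 := by
  obtain ⟨B, hmin⟩ := exists_minimal_basis x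
  have hX := isCyclicallyReduced_of_minimal hmin
  have hall := exists_mem_reducedWord_of_not_isSeparable B hx
  have hne : Nonempty (IsFreeGroup.Generators F) := by
    by_contra hempty
    rw [not_nonempty_iff] at hempty
    exact not_subsingleton F B.repr.toEquiv.subsingleton
  obtain ⟨i⟩ := hne
  have hx1 : x ≠ 1 := by
    rintro rfl
    obtain ⟨b, hb⟩ := hall i
    simp at hb
  have hx2 : x ^ 2 ≠ 1 := by
    intro h
    have h1 : (B.repr x) ^ 2 = 1 := by rw [← map_pow, h, _root_.map_one]
    rw [pow_eq_one_iff_left two_ne_zero] at h1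
    exact hx1 (by simpa using h1)
  obtain ⟨q, hq, hqd⟩ := exists_homogenization (abs_brooks_le B hx2)
  have hq' := hq.isHomogeneousQuasimorphism (brooks_inv B _) (abs_brooks_le B hx2) hqd
  refine ⟨_, B, q, hX, hq, hq', ?_, ?_⟩
  · rcases subsingleton_or_nontrivial (IsFreeGroup.Generators F) with hsub | hnt
    · exact ⟨_, fun p hp => abs_map_primitive_le_of_subsingleton B i hq' hp⟩
    -- Every generator occurs in the finite word of `x`.
    · have hfin : Finite (IsFreeGroup.Generators F) :=
        (Fintype.ofList ((B.repr x).toWord.map Prod.fst) fun j => by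
          obtain ⟨b, hb⟩ := hall j
          exact List.mem_map.2 ⟨_, hb, rfl⟩).finite
      refine ⟨0, fun p hp => ?_⟩
      have h1 := homogenization_nonpos_of_isPrimitive B hmin hall hq hq' hp
      -- Inverses of primitive elements are primitive, so the one-sided bound gives `q p = 0`.
      have h2 := homogenization_nonpos_of_isPrimitive B hmin hall hq hq' hp.inv
      rw [hq.map_inv (brooks_inv B _)] at h2
      rw [abs_le]
      constructor <;> linarith
  · have := one_le_homogenization_brooks_sq B hX hx1 hq
    intro h
    linarith

end Main

end AutNorm

theorem theorem2 {F : Type*} [Group F] [IsFreeGroup F] [Nontrivial F] (x : F) :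
    (AutNorm.IsSeparable x ∧
      (∀ n : ℤ, AutNorm.primitiveNorm (x ^ n) ≤ 2) ∧
      (∀ N : F → ℕ, AutNorm.IsAutNorm N → AutNorm.IsBoundedIn N x)) ∨
    (¬ AutNorm.IsSeparable x ∧
      AutNorm.IsUndistorted AutNorm.primitiveNorm x ∧
      (∀ N : F → ℕ, AutNorm.IsAutNorm N → AutNorm.IsUndistorted N x) ∧
      ∃ (ι : Type _) (B : FreeGroupBasis ι F) (q : F → ℝ),
        FreeGroup.IsCyclicallyReduced (AutNorm.reducedWord B x) ∧
        AutNorm.IsHomogenization (AutNorm.brooks B (x ^ 2)) q ∧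
        AutNorm.IsHomogeneousQuasimorphism q ∧
        (∃ C : ℝ, ∀ p : F, AutNorm.IsPrimitive p → |q p| ≤ C) ∧
        q x ≠ 0) := by
  by_cases hx : AutNorm.IsSeparable x
  · exact Or.inl ⟨hx, hx.primitiveNorm_zpow_le, fun N hN => hx.isBoundedIn hN⟩
  · obtain ⟨ι, B, q, hX, hq, hq', ⟨C, hC⟩, hqx⟩ :=
      AutNorm.exists_brooks_quasimorphism_of_not_isSeparable hx
    have hund := AutNorm.isUndistorted_primitiveNorm_of_quasimorphism hq' hC hqx
    exact Or.inr ⟨hx, hund,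
      fun N hN => AutNorm.isUndistorted_of_isUndistorted_primitiveNorm hund hN,
      ι, B, q, hX, hq, hq', ⟨C, hC⟩, hqx⟩
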